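/- **Setting.** Let $K,L\ge 1$ and let $f_1,\dots,f_K\in[0,1)$ be distinct frequencies, $z_k=e^{i2\pi f_k}$, $\mathbf Z=\mathrm{diag}(z_1,\dots,z_K)$. For $n\ge 1$ let $\mathbf A_n$ be the $n\times K$ Vandermonde matrix with $(r,k)$ entry $z_k^{r-1}$, and put $\mathbf A=\mathbf A_N$. Let $\mathbf S\in\mathbb C^{K\times L}$ be a fixed source matrix (all probabilities are conditional on the sources) and let $\mathbf Y=\mathbf A\mathbf S+\mathbf E\in\mathbb C^{N\times L}$, where the entries of $\mathbf E$ are i.i.d. circularly symmetric complex Gaussian with mean zero and variance $\sigma^2$, $\sigma\ge 0$. Write $\|\cdot\|$ for the spectral norm, $\sigma_K(\cdot)$ and $\lambda_K(\cdot)$ for the $K$-th greatest singular value and eigenvalue, $\odot$ for the entrywise product, and a bar for the entrywise complex conjugate. Let $\widehat{\mathbf\Sigma}=\frac1L\mathbf S\mathbf S^H$ and $\widehat{\mathbf R}=\frac1L\mathbf Y\mathbf Y^H$. For $M\le N$ and $P=N-M+1$, let $\mathbf Y_{(p)}$ consist of the rows $p,\dots,p+M-1$ of $\mathbf Y$ $(p=1,\dots,P)$,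 let $\mathbf J$ be the $M\times M$ reversal matrix (ones on the anti-diagonal, zeros elsewhere), and let $$\widehat{\mathbf R}_{SS}=\frac1{LP}\sum_{p=1}^P\mathbf Y_{(p)}\mathbf Y_{(p)}^H,\qquad \widehat{\mathbf R}'_{SS}=\tfrac12\bigl(\widehat{\mathbf R}_{SS}+\mathbf J\,\overline{\widehat{\mathbf R}_{SS}}\,\mathbf J\bigr),$$ $$\widehat{\mathbf\Sigma}_{SS}=\widehat{\mathbf\Sigma}\odot\mathbf C_P,\quad \mathbf C_P=\tfrac1P\overline{\mathbf A_P^H\mathbf A_P},\qquad \widehat{\mathbf\Sigma}'_{SS}=\tfrac12\bigl(\widehat{\mathbf\Sigma}_{SS}+\mathbf Z^{1-M}\,\overline{\widehat{\mathbf\Sigma}_{SS}}\,\mathbf Z^{M-1}\bigr).$$ Given a Hermitian $n\times n$ matrix with $n\ge K+1$, let $\widehat{\mathbf U}$ be the matrix of $K$ orthonormal eigenvectors for its $K$ greatest eigenvalues, and let $\widehat{\mathbf U}_1$, $\widehat{\mathbf U}_2$ be $\widehat{\mathbf U}$ without its last, respectively first, row. The frequency estimates $\widehat f_1,\dots,\widehat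 f_K\in[0,1)$ are the angles, divided by $2\pi$, of the eigenvalues (with algebraic multiplicity) of $\widehat{\mathbf U}_1^\dagger\widehat{\mathbf U}_2$, where $\dagger$ is the Moore–Penrose pseudo-inverse; where there is a choice (of eigenvectors, or of the angle of a zero eigenvalue) the claim is that, on the event in question, the bound holds for every choice. ESPRIT, FOSS-ESPRIT and FBSS-ESPRIT apply this to $\widehat{\mathbf R}$, $\widehat{\mathbf R}_{SS}$ and $\widehat{\mathbf R}'_{SS}$, respectively. The matched distance is $$\mathrm{md}(\widehat{\mathcal T},\mathcal T)=\min_\psi\max_k\min\bigl\{|\widehat f_{\psi(k)}-f_k|,\,1-|\widehat f_{\psi(k)}-f_k|\bigr\},$$ with $\psi$ ranging over the permutations of $\{1,\dots,K\}$. **Theorem.** 1. If $N\ge K+1$ and $\widehat{\mathbf\Sigma}$ is positive definite, then for ESPRIT, with probability at least $1-3e^{-N/2}$, $$\mathrm{md}(\widehat{\mathcal T},\mathcal T)\le\min\left\{1,\;2^{2K+4}K^{3/2}\sqrt N\cdot\frac{12\sigma\|\mathbf A\|\|\widehat{\mathbf\Sigma}\|^{1/2}\sqrt{\frac NL}+16\sigma^2\max\bigl\{\sqrt{\frac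 NL},\frac NL\bigr\}}{\sigma_K^3(\mathbf A)\,\lambda_K(\widehat{\mathbf\Sigma})}\right\}.$$ 2. If $N\ge M\ge K+1$ and $\widehat{\mathbf\Sigma}_{SS}$ is positive definite, then for FOSS-ESPRIT, with probability at least $1-3Pe^{-M/2}$, $$\mathrm{md}(\widehat{\mathcal T},\mathcal T)\le\min\left\{1,\;2^{2K+4}K^{3/2}\sqrt M\cdot\frac{12\sigma\|\mathbf A_M\|\|\widehat{\mathbf\Sigma}\|^{1/2}\sqrt{\frac ML}+16\sigma^2\max\bigl\{\sqrt{\frac ML},\frac ML\bigr\}}{\sigma_K^3(\mathbf A_M)\,\lambda_K(\widehat{\mathbf\Sigma}_{SS})}\right\}.$$ 3. If $N\ge M\ge K+1$ and $\widehat{\mathbf\Sigma}'_{SS}$ is positive definite, then for FBSS-ESPRIT, with probability at least $1-3Pe^{-M/2}$, the bound of part 2 holds with $\lambda_K(\widehat{\mathbf\Sigma}'_{SS})$ in place of $\lambda_K(\widehat{\mathbf\Sigma}_{SS})$. -/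

import Mathlib

open MeasureTheory ProbabilityTheory
open scoped Matrix Matrix.Norms.L2Operator ComplexOrder

namespace Esprit

/-! ### Matrix notions.

With the scope `Matrix.Norms.L2Operator` open, `‖A‖` is the spectral norm of a matrix `A`. -/

/-- The `j`-th greatest singular value (`j = 1, 2, …`, counted with multiplicity). -/
noncomputable def singularValue {m n : ℕ} (j : ℕ) (A : Matrix (Fin m) (Fin n) ℂ) : ℝ :=
  (Matrix.toEuclideanLin A).singularValues (j - 1)

open Classical in
/-- The `j`-th greatest eigenvalue (`j = 1, …, n`, counted with multiplicity) of a Hermitian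
`n × n` matrix. The value is `0` if the matrix is not Hermitian or `j` is out of range. -/
noncomputable def eigenvalue {n : ℕ} (j : ℕ) (B : Matrix (Fin n) (Fin n) ℂ) : ℝ :=
  if h : B.IsHermitian ∧ 1 ≤ j ∧ j ≤ Fintype.card (Fin n) then
    h.1.eigenvalues₀ ⟨j - 1, by omega⟩
  else 0

/-- `X` is the Moore–Penrose pseudo-inverse of `A` (the four Penrose equations, which determine
`X` uniquely). -/
structure IsPseudoInverse {m n : ℕ} (A : Matrix (Fin m) (Fin n) ℂ)
    (X : Matrix (Fin n) (Fin m) ℂ) : Prop where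
  mul_mul_self : A * X * A = A
  self_mul_mul : X * A * X = X
  isHermitian_left : (A * X)ᴴ = A * X
  isHermitian_right : (X * A)ᴴ = X * A

/-! ### The data model. -/

/-- The point `exp (2πif)` of the unit circle. -/
noncomputable def node (f : ℝ) : ℂ :=
  Complex.exp (2 * (Real.pi : ℂ) * Complex.I * (f : ℂ))

/-- The `n × K` Vandermonde matrix with entries `exp (2πi r f_k)`, with rows `r = 0, …, n - 1`. -/
noncomputable def steeringMatrix {K : ℕ} (n : ℕ) (f : Fin K → ℝ) : Matrix (Fin n) (Fin K) ℂ :=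
  Matrix.of fun r k => node (f k) ^ (r : ℕ)

/-- The diagonal matrix `Z = diag (z_1, …, z_K)` with `z_k = exp (2πi f_k)`. -/
noncomputable def nodeMatrix {K : ℕ} (f : Fin K → ℝ) : Matrix (Fin K) (Fin K) ℂ :=
  Matrix.diagonal fun k => node (f k)

/-- The law of a circularly symmetric complex Gaussian variable with mean zero and variance
`σ ^ 2`: the real and imaginary parts are independent with law `N(0, σ ^ 2 / 2)`. -/
noncomputable def complexGaussian (σ : ℝ) : Measure ℂ :=
  ((gaussianReal 0 (σ ^ 2 / 2).toNNReal).prod (gaussianReal 0 (σ ^ 2 / 2).toNNReal)).map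
    fun x => (x.1 : ℂ) + (x.2 : ℂ) * Complex.I

/-- The entries of the random matrix `E` are i.i.d. complex Gaussian with mean zero and
variance `σ ^ 2`. -/
structure IsGaussianNoise {Ω : Type*} [MeasurableSpace Ω] (μ : Measure Ω) (σ : ℝ) {N L : ℕ}
    (E : Ω → Matrix (Fin N) (Fin L) ℂ) : Prop where
  indep : iIndepFun (fun (q : Fin N × Fin L) (ω : Ω) => E ω q.1 q.2) μ
  law : ∀ i j, HasLaw (fun ω => E ω i j) (complexGaussian σ) μ

/-- The sample covariance matrix `(1 / L) Y Yᴴ` of `n × L` data `Y`. For the data matrix this is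
the matrix from which ESPRIT starts, for the matrix of sources it is the sample source
covariance. -/
noncomputable def sampleCov {n L : ℕ} (Y : Matrix (Fin n) (Fin L) ℂ) :
    Matrix (Fin n) (Fin n) ℂ :=
  (1 / (L : ℂ)) • (Y * Yᴴ)

/-! ### Spatial smoothing, with `P = N - M + 1` subarrays of `M` elements. -/

/-- The data of the subarray that starts at row `p = 0, …, P - 1`: the rows
`p, p + 1, …, p + M - 1` of `Y`. -/
def subarray {N L : ℕ} (M : ℕ) (hM : M ≤ N) (p : Fin (N - M + 1))
    (Y : Matrix (Fin N) (Fin L) ℂ) : Matrix (Fin M) (Fin L) ℂ :=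
  Y.submatrix (fun i => ⟨p.1 + i.1, by omega⟩) id

/-- The forward-only smoothed sample covariance matrix
`(1 / P) ∑ p, (1 / L) Y_(p) Y_(p)ᴴ`. -/
noncomputable def fossCov {N L : ℕ} (M : ℕ) (hM : M ≤ N) (Y : Matrix (Fin N) (Fin L) ℂ) :
    Matrix (Fin M) (Fin M) ℂ :=
  (1 / ((N - M + 1 : ℕ) : ℂ)) • ∑ p : Fin (N - M + 1), sampleCov (subarray M hM p Y)

/-- The entrywise complex conjugate of a matrix. -/
def conj {m n : ℕ} (B : Matrix (Fin m) (Fin n) ℂ) : Matrix (Fin m) (Fin n) ℂ :=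
  B.map (starRingEnd ℂ)

/-- The `n × n` reversal matrix: ones on the anti-diagonal and zeros elsewhere. -/
def reversal (n : ℕ) : Matrix (Fin n) (Fin n) ℂ :=
  Matrix.of fun i j => if j = Fin.rev i then 1 else 0

/-- The forward-backward smoothed sample covariance matrix `(R + J (conj R) J) / 2`, where `R` is
the forward-only one. -/
noncomputable def fbssCov {N L : ℕ} (M : ℕ) (hM : M ≤ N) (Y : Matrix (Fin N) (Fin L) ℂ) :
    Matrix (Fin M) (Fin M) ℂ :=
  (1 / 2 : ℂ) • (fossCov M hM Y + reversal M * conj (fossCov M hM Y) * reversal M)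

/-- The correlation matrix `C_P = (1 / P) conj (A_Pᴴ A_P)`. -/
noncomputable def corrMatrix {K : ℕ} (P : ℕ) (f : Fin K → ℝ) : Matrix (Fin K) (Fin K) ℂ :=
  (1 / (P : ℂ)) • conj ((steeringMatrix P f)ᴴ * steeringMatrix P f)

/-- The forward-only smoothed sample source covariance `Σ̂ ⊙ C_P`, where `Σ̂` is the sample
covariance of the sources `S`. -/
noncomputable def fossSourceCov {K L : ℕ} (P : ℕ) (f : Fin K → ℝ)
    (S : Matrix (Fin K) (Fin L) ℂ) : Matrix (Fin K) (Fin K) ℂ :=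
  sampleCov S ⊙ corrMatrix P f

/-- The forward-backward smoothed sample source covariance
`(B + Z ^ (1 - M) (conj B) Z ^ (M - 1)) / 2`, where `B` is the forward-only one. -/
noncomputable def fbssSourceCov {K L : ℕ} (M P : ℕ) (f : Fin K → ℝ)
    (S : Matrix (Fin K) (Fin L) ℂ) : Matrix (Fin K) (Fin K) ℂ :=
  (1 / 2 : ℂ) • (fossSourceCov P f S +
    nodeMatrix f ^ (1 - (M : ℤ)) * conj (fossSourceCov P f S) * nodeMatrix f ^ ((M : ℤ) - 1))

/-! ### The ESPRIT algorithm. -/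

/-- `U` consists of the first `K` eigenvectors in an eigendecomposition of the Hermitian matrix
`R` with eigenvalues in descending order. -/
def IsLeadingEigenbasis {n K : ℕ} (hK : K ≤ n) (R : Matrix (Fin n) (Fin n) ℂ)
    (U : Matrix (Fin n) (Fin K) ℂ) : Prop :=
  ∃ (V : Matrix (Fin n) (Fin n) ℂ) (d : Fin n → ℝ),
    V ∈ Matrix.unitaryGroup (Fin n) ℂ ∧ Antitone d ∧
    R = V * Matrix.diagonal (fun i => (d i : ℂ)) * Vᴴ ∧
    U = V.submatrix id (Fin.castLE hK)

/-- `U` without its last row. -/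
def dropLastRow {n K : ℕ} (U : Matrix (Fin n) (Fin K) ℂ) : Matrix (Fin (n - 1)) (Fin K) ℂ :=
  U.submatrix (fun i => ⟨i.1, by omega⟩) id

/-- `U` without its first row. -/
def dropFirstRow {n K : ℕ} (U : Matrix (Fin n) (Fin K) ℂ) : Matrix (Fin (n - 1)) (Fin K) ℂ :=
  U.submatrix (fun i => ⟨i.1 + 1, by omega⟩) id

/-- `g` is a vector of frequency estimates which ESPRIT may return for `K` frequencies when it is
run on the (smoothed) sample covariance matrix `R`: the entries of `g` are the angles, as numbers
in `[0, 1)`, of the eigenvalues of `U₁^† U₂`, listed with algebraic multiplicity, where `U₁` and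
`U₂` arise from the matrix `U` of leading eigenvectors of `R` by removal of the last and of the
first row. The choice of the eigenvectors, the order of the eigenvalues and the angle of an
eigenvalue that vanishes are arbitrary. -/
def IsEspritEstimate {n K : ℕ} (hK : K ≤ n) (R : Matrix (Fin n) (Fin n) ℂ)
    (g : Fin K → ℝ) : Prop :=
  ∃ (U : Matrix (Fin n) (Fin K) ℂ) (X : Matrix (Fin K) (Fin (n - 1)) ℂ) (z : Fin K → ℂ),
    IsLeadingEigenbasis hK R U ∧
    IsPseudoInverse (dropLastRow U) X ∧
    (X * dropFirstRow U).charpoly = ∏ k, (Polynomial.X - Polynomial.C (z k)) ∧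
    ∀ k, g k ∈ Set.Ico (0 : ℝ) 1 ∧ z k = (‖z k‖ : ℂ) * node (g k)

/-- The matched (wrap-around) distance of two families of `K` frequencies in `[0, 1)`. -/
noncomputable def matchedDist {K : ℕ} (g f : Fin K → ℝ) : ℝ :=
  ⨅ ψ : Equiv.Perm (Fin K), ⨆ k : Fin K, min |g (ψ k) - f k| (1 - |g (ψ k) - f k|)

/-- The error bound, as a function of the `M × K` Vandermonde matrix `A`, the sample source
covariance `B` and its (smoothed) version `B'`. -/
noncomputable def errorBound {M K : ℕ} (L : ℕ) (σ : ℝ) (A : Matrix (Fin M) (Fin K) ℂ)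
    (B B' : Matrix (Fin K) (Fin K) ℂ) : ℝ :=
  min 1 (2 ^ (2 * K + 4) * (K : ℝ) ^ (3 / 2 : ℝ) * √(M : ℝ) *
    ((12 * σ * ‖A‖ * ‖B‖ ^ (1 / 2 : ℝ) * √((M : ℝ) / L)
        + 16 * σ ^ 2 * max (√((M : ℝ) / L)) ((M : ℝ) / L))
      / (singularValue K A ^ 3 * eigenvalue K B')))

/-- The property `Q` holds with probability at least `p`: it holds on an event of probability at
least `p`. -/
def HoldsWithProbAtLeast {Ω : Type*} [MeasurableSpace Ω] (μ : Measure Ω) (p : ℝ)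
    (Q : Ω → Prop) : Prop :=
  ∃ G : Set Ω, MeasurableSet G ∧ p ≤ μ.real G ∧ ∀ ω ∈ G, Q ω

end Esprit

/-! Each of the three covariance matrices has the form `A B Aᴴ + σ² I + D`, where `A` is a
Vandermonde matrix, `B` the (smoothed) sample source covariance and `D` is small. The noise floor
`σ² I` moves no eigenvector, so a deterministic bound in terms of `δ ≥ ‖D‖` and a probabilistic
bound on `‖D‖` suffice.

Deterministic part. On the range of `A` the quadratic form of `A B Aᴴ` is at least `γ = σ_K(A)²
λ_K(B)` times the squared norm (`gap_mul_le`). By a Courant–Fischer argument the leading eigenvalues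
exceed the noise floor by at least `γ - δ`, and the eigenvalue equation then gives `U = A G` up to
an error `δ / (γ - δ)` (`IsLeadingEigenbasis.exists_approx`). A shift of the rows acts on `A` as
`Z`, so `U₁^† U₂` is similar, through `G`, to `Z + F` with small `F`
(`exists_similar_perturbation`). The pseudo-inverse stays bounded because the removal of the last
row of `A` costs at most a factor `2 ^ K`, however close the nodes are
(`vecNorm_steeringMatrix_mulVec_le`). The eigenvalues of `Z + F` match the nodes within `2 K ‖F‖` by
a root count along `Z + t F` (`exists_perm_norm_sub_le`), and the passage to angles halves this
(`wrapDist_le_half_norm`). The resulting bound is better than the claim by a factor `2 ^ K`; the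
spare factor ensures that all perturbations are small whenever the claim is nontrivial, that is,
below `1 / 2`.

Probabilistic part. Quarter-nets of the unit sphere reduce the norms of `E Sᴴ` and `E Eᴴ / L - σ² I`
to sums of squared moduli of i.i.d. complex Gaussians, which have explicit exponential moments;
Chernoff and union bounds give the failure probability `3 e^{-M/2}`
(`IsGaussianNoise.measure_not_isTypicalNoise_le`). Subarray `p` sees the sources `Z ^ p S` through
the same `A_M`, so smoothing averages matrices of the same form with the same bound on the
deviation, and a union over the `P` subarrays finishes. -/

namespace Esprit

/-! ### The Euclidean norm of a vector and the spectral norm -/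

/-- The Euclidean norm of a complex vector. -/
noncomputable def vecNorm {ι : Type*} [Fintype ι] (v : ι → ℂ) : ℝ :=
  ‖(WithLp.toLp 2 v : EuclideanSpace ℂ ι)‖

section VecNorm

variable {ι κ : Type*} [Fintype ι] [Fintype κ]

lemma vecNorm_nonneg (v : ι → ℂ) : 0 ≤ vecNorm v := norm_nonneg _

lemma vecNorm_sq (v : ι → ℂ) : vecNorm v ^ 2 = ∑ i, ‖v i‖ ^ 2 := by
  simp [vecNorm, EuclideanSpace.norm_sq_eq]

lemma vecNorm_add_le (v w : ι → ℂ) : vecNorm (v + w) ≤ vecNorm v + vecNorm w :=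
  norm_add_le (WithLp.toLp 2 v : EuclideanSpace ℂ ι) (WithLp.toLp 2 w)

lemma vecNorm_sub_le (v w : ι → ℂ) : vecNorm (v - w) ≤ vecNorm v + vecNorm w :=
  norm_sub_le (WithLp.toLp 2 v : EuclideanSpace ℂ ι) (WithLp.toLp 2 w)

lemma vecNorm_smul (c : ℂ) (v : ι → ℂ) : vecNorm (c • v) = ‖c‖ * vecNorm v :=
  norm_smul c (WithLp.toLp 2 v : EuclideanSpace ℂ ι)

lemma vecNorm_eq_zero {v : ι → ℂ} : vecNorm v = 0 ↔ v = 0 := by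
  simp [vecNorm]

lemma vecNorm_zero : vecNorm (0 : ι → ℂ) = 0 := vecNorm_eq_zero.2 rfl

lemma vecNorm_pos {v : ι → ℂ} (hv : v ≠ 0) : 0 < vecNorm v :=
  (vecNorm_nonneg v).lt_of_ne fun h => hv (vecNorm_eq_zero.1 h.symm)

lemma norm_star_dotProduct_le (v w : ι → ℂ) : ‖star v ⬝ᵥ w‖ ≤ vecNorm v * vecNorm w := by
  have := norm_inner_le_norm (𝕜 := ℂ) (WithLp.toLp 2 v : EuclideanSpace ℂ ι) (WithLp.toLp 2 w)
  rwa [EuclideanSpace.inner_toLp_toLp, dotProduct_comm] at this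

lemma star_dotProduct_self (v : ι → ℂ) : star v ⬝ᵥ v = ((vecNorm v ^ 2 : ℝ) : ℂ) := by
  rw [vecNorm_sq]
  simp [dotProduct, Complex.conj_mul']

lemma vecNorm_mulVec_le [DecidableEq ι] (A : Matrix κ ι ℂ) (v : ι → ℂ) :
    vecNorm (A *ᵥ v) ≤ ‖A‖ * vecNorm v :=
  Matrix.l2_opNorm_mulVec A (WithLp.toLp 2 v)

lemma opNorm_le_of_mulVec [DecidableEq ι] (A : Matrix κ ι ℂ) {C : ℝ} (hC : 0 ≤ C)
    (h : ∀ v, vecNorm (A *ᵥ v) ≤ C * vecNorm v) : ‖A‖ ≤ C := by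
  rw [Matrix.l2_opNorm_def]
  exact ContinuousLinearMap.opNorm_le_bound _ hC fun v => h v.ofLp

lemma mulVec_star_dotProduct (A : Matrix κ ι ℂ) (v : ι → ℂ) (w : κ → ℂ) :
    star (A *ᵥ v) ⬝ᵥ w = star v ⬝ᵥ (Aᴴ *ᵥ w) := by
  rw [Matrix.star_mulVec, ← Matrix.dotProduct_mulVec]

lemma vecNorm_mulVec_of_isometry [DecidableEq ι] {U : Matrix κ ι ℂ} (hU : Uᴴ * U = 1)
    (v : ι → ℂ) : vecNorm (U *ᵥ v) = vecNorm v := by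
  have h : star (U *ᵥ v) ⬝ᵥ (U *ᵥ v) = star v ⬝ᵥ v := by
    rw [mulVec_star_dotProduct, Matrix.mulVec_mulVec, hU, Matrix.one_mulVec]
  rw [star_dotProduct_self, star_dotProduct_self] at h
  exact (sq_eq_sq₀ (vecNorm_nonneg _) (vecNorm_nonneg _)).1 (by exact_mod_cast h)

lemma opNorm_le_frobenius [DecidableEq ι] (A : Matrix κ ι ℂ) :
    ‖A‖ ≤ √(∑ i, ∑ j, ‖A i j‖ ^ 2) := by
  refine opNorm_le_of_mulVec A (Real.sqrt_nonneg _) fun v => ?_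
  refine le_of_sq_le_sq ?_ (mul_nonneg (Real.sqrt_nonneg _) (vecNorm_nonneg _))
  rw [mul_pow, Real.sq_sqrt (by positivity), vecNorm_sq, vecNorm_sq, Finset.sum_mul]
  refine Finset.sum_le_sum fun i _ => ?_
  calc ‖(A *ᵥ v) i‖ ^ 2 ≤ (∑ j, ‖A i j‖ * ‖v j‖) ^ 2 := by
        refine pow_le_pow_left₀ (norm_nonneg _) ?_ 2
        refine (norm_sum_le _ _).trans (Finset.sum_le_sum fun j _ => ?_)
        rw [norm_mul]
    _ ≤ _ := Finset.sum_mul_sq_le_sq_mul_sq _ _ _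

end VecNorm

/-! ### The least eigenvalue and the least singular value -/

/-- In an orthonormal eigenbasis the quadratic form is a sum of eigenvalues weighted by squared
coordinates, and the last eigenvalue is the least because the list decreases. -/
lemma eigenvalues_last_mul_le {E : Type*} [NormedAddCommGroup E] [InnerProductSpace ℂ E]
    [FiniteDimensional ℂ E] {T : E →ₗ[ℂ] E} (hT : T.IsSymmetric) {n : ℕ}
    (hn : Module.finrank ℂ E = n) (i : Fin n) (hi : i.1 = n - 1) (x : E) :
    hT.eigenvalues hn i * ‖x‖ ^ 2 ≤ (inner ℂ x (T x)).re := by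
  set b := hT.eigenvectorBasis hn
  have h1 : inner ℂ x (T x) = ((∑ j, hT.eigenvalues hn j * ‖inner ℂ (b j) x‖ ^ 2 : ℝ) : ℂ) := by
    rw [← b.sum_inner_mul_inner, Complex.ofReal_sum]
    refine Finset.sum_congr rfl fun j _ => ?_
    have h2 := hT.eigenvectorBasis_apply_self_apply hn x j
    rw [OrthonormalBasis.repr_apply_apply, OrthonormalBasis.repr_apply_apply] at h2
    change inner ℂ (b j) (T x) = _ * inner ℂ (b j) x at h2
    rw [h2, ← inner_conj_symm x (b j), mul_left_comm, Complex.conj_mul']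
    push_cast
    rfl
  rw [h1, Complex.ofReal_re, ← b.sum_sq_norm_inner_right x, Finset.mul_sum]
  refine Finset.sum_le_sum fun j _ => mul_le_mul_of_nonneg_right ?_ (sq_nonneg _)
  exact hT.eigenvalues_antitone hn (by rw [Fin.le_def]; omega)

lemma singularValue_mul_vecNorm_le {m n : ℕ} (hn : 1 ≤ n) (A : Matrix (Fin m) (Fin n) ℂ)
    (y : Fin n → ℂ) : singularValue n A * vecNorm y ≤ vecNorm (A *ᵥ y) := by
  set T := Matrix.toEuclideanLin A
  have hf : Module.finrank ℂ (EuclideanSpace ℂ (Fin n)) = n := by simp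
  have hs := T.singularValues_of_lt hf (i := n - 1) (by omega)
  have hs2 := T.sq_singularValues_of_lt hf (i := n - 1) (by omega)
  have h := eigenvalues_last_mul_le T.isSymmetric_adjoint_comp_self hf ⟨n - 1, by omega⟩ rfl
    (WithLp.toLp 2 y)
  rw [← hs2, LinearMap.comp_apply, LinearMap.adjoint_inner_right] at h
  rw [show inner ℂ (T (WithLp.toLp 2 y)) (T (WithLp.toLp 2 y)) =
    ((‖T (WithLp.toLp 2 y)‖ ^ 2 : ℝ) : ℂ) by rw [inner_self_eq_norm_sq_to_K]; simp,
    Complex.ofReal_re, ← mul_pow] at h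
  exact le_of_sq_le_sq h (norm_nonneg _)

lemma singularValue_pos {m n : ℕ} (hn : 1 ≤ n) (A : Matrix (Fin m) (Fin n) ℂ)
    (hA : ∀ y, A *ᵥ y = 0 → y = 0) : 0 < singularValue n A := by
  have hinj : Function.Injective (Matrix.toEuclideanLin A) := by
    rw [injective_iff_map_eq_zero]
    intro y hy
    have := hA y.ofLp (by simpa using congrArg WithLp.ofLp hy)
    ext i
    exact congrFun this i
  exact (LinearMap.injective_iff_forall_lt_finrank_singularValues_pos _).1 hinj (n - 1)
    (by simp; omega)

lemma eigenvalue_mul_le {n : ℕ} (hn : 1 ≤ n) {B : Matrix (Fin n) (Fin n) ℂ} (hB : B.IsHermitian)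
    (y : Fin n → ℂ) : eigenvalue n B * vecNorm y ^ 2 ≤ (star y ⬝ᵥ (B *ᵥ y)).re := by
  have hc : B.IsHermitian ∧ 1 ≤ n ∧ n ≤ Fintype.card (Fin n) := ⟨hB, hn, by simp⟩
  rw [eigenvalue, dif_pos hc]
  have h := eigenvalues_last_mul_le (Matrix.isSymmetric_toEuclideanLin_iff.2 hB)
    (finrank_euclideanSpace (𝕜 := ℂ) (ι := Fin n)) ⟨n - 1, by simp; omega⟩ (by simp)
    (WithLp.toLp 2 y)
  refine h.trans_eq ?_
  rw [dotProduct_comm]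
  rfl

lemma eigenvalue_pos {n : ℕ} (hn : 1 ≤ n) {B : Matrix (Fin n) (Fin n) ℂ} (hB : B.PosDef) :
    0 < eigenvalue n B := by
  have hc : B.IsHermitian ∧ 1 ≤ n ∧ n ≤ Fintype.card (Fin n) := ⟨hB.1, hn, by simp⟩
  rw [eigenvalue, dif_pos hc]
  have := hB.eigenvalues_pos (Fintype.equivOfCardEq (Fintype.card_fin _) ⟨n - 1, by simp; omega⟩)
  rwa [Matrix.IsHermitian.eigenvalues, Equiv.symm_apply_apply] at this

/-! ### Vandermonde matrices with nodes on the unit circle -/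

lemma norm_node (f : ℝ) : ‖node f‖ = 1 := by
  rw [node, show 2 * (Real.pi : ℂ) * Complex.I * (f : ℂ) = ((2 * Real.pi * f : ℝ) : ℂ) * Complex.I
    by push_cast; ring]
  exact Complex.norm_exp_ofReal_mul_I _

lemma norm_node_sub_node (a b : ℝ) : ‖node a - node b‖ = 2 * |Real.sin (Real.pi * (a - b))| := by
  have h : node a - node b = node b * (Complex.exp (Complex.I * ((2 * Real.pi * (a - b) : ℝ) : ℂ)) - 1) := by
    rw [mul_sub, node, node, ← Complex.exp_add, mul_one]
    congr 2
    push_cast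
    ring
  rw [h, norm_mul, norm_node, one_mul, Complex.norm_exp_I_mul_ofReal_sub_one, norm_mul]
  simp only [Real.norm_eq_abs, abs_two]
  congr 3
  ring

/-- The chord is `2 |sin (π (a - b))|`; Jordan's inequality `sin x ≥ 2x/π` on `[0, π/2]` applies to
`π t` or to `π (1 - t)`, whichever lies in that interval. -/
lemma four_mul_wrapDist_le {a b : ℝ} (ha : a ∈ Set.Ico (0 : ℝ) 1) (hb : b ∈ Set.Ico (0 : ℝ) 1) :
    4 * min |a - b| (1 - |a - b|) ≤ ‖node a - node b‖ := by
  set t := |a - b| with ht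
  have ht0 : 0 ≤ t := abs_nonneg _
  have ht1 : t < 1 := by
    rw [ht, abs_lt]
    constructor <;> linarith [ha.1, ha.2, hb.1, hb.2]
  have hs : |Real.sin (Real.pi * (a - b))| = Real.sin (Real.pi * t) := by
    rw [← abs_of_nonneg (Real.sin_nonneg_of_nonneg_of_le_pi (x := Real.pi * t)
      (by positivity) (by nlinarith [Real.pi_pos]))]
    rcases abs_choice (a - b) with h | h
    · rw [ht, h]
    · rw [ht, h, mul_neg, Real.sin_neg, abs_neg]
  rw [norm_node_sub_node, hs]
  rcases le_total t (1 / 2) with h | h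
  · have := Real.mul_le_sin (x := Real.pi * t) (by positivity) (by nlinarith [Real.pi_pos])
    rw [show 2 / Real.pi * (Real.pi * t) = 2 * t by field_simp] at this
    linarith [min_le_left t (1 - t)]
  · have := Real.mul_le_sin (x := Real.pi * (1 - t)) (mul_nonneg Real.pi_pos.le (by linarith))
      (by nlinarith [Real.pi_pos])
    rw [show 2 / Real.pi * (Real.pi * (1 - t)) = 2 * (1 - t) by field_simp,
      show Real.pi * (1 - t) = Real.pi - Real.pi * t by ring, Real.sin_pi_sub] at this
    linarith [min_le_right t (1 - t)]

lemma node_injOn : Set.InjOn node (Set.Ico (0 : ℝ) 1) := by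
  intro a ha b hb hab
  have h := four_mul_wrapDist_le ha hb
  rw [hab, sub_self, norm_zero] at h
  have h1 : 0 < 1 - |a - b| := by
    rw [sub_pos, abs_lt]
    constructor <;> linarith [ha.1, ha.2, hb.1, hb.2]
  rcases min_le_iff.1 (show min |a - b| (1 - |a - b|) ≤ 0 by linarith) with h2 | h2
  · exact sub_eq_zero.1 (abs_nonpos_iff.1 h2)
  · linarith

section Steering

variable {K : ℕ} {f : Fin K → ℝ}

lemma steeringMatrix_mulVec_injective (hf : ∀ k, f k ∈ Set.Ico (0 : ℝ) 1)
    (hf_inj : Function.Injective f) {n : ℕ} (hn : K ≤ n) {y : Fin K → ℂ}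
    (hy : steeringMatrix n f *ᵥ y = 0) : y = 0 := by
  refine Matrix.eq_zero_of_forall_pow_sum_mul_pow_eq_zero (f := fun k => node (f k))
    (fun i j hij => hf_inj (node_injOn (hf i) (hf j) hij)) fun i => ?_
  have := congrFun hy ⟨i, i.2.trans_le hn⟩
  simpa [Matrix.mulVec, dotProduct, steeringMatrix, mul_comm] using this

lemma norm_steeringMatrix_le (n : ℕ) : ‖steeringMatrix n f‖ ≤ √(n : ℝ) * √(K : ℝ) := by
  refine (opNorm_le_frobenius _).trans_eq ?_
  rw [← Real.sqrt_mul (Nat.cast_nonneg _)]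
  simp [steeringMatrix, norm_node]

lemma sum_norm_coeff_mul_X_le {p : Polynomial ℂ} {c : ℝ}
    (h : ∀ N, ∑ i ∈ Finset.range N, ‖p.coeff i‖ ≤ c) (N : ℕ) :
    ∑ i ∈ Finset.range N, ‖(p * Polynomial.X).coeff i‖ ≤ c := by
  cases N with
  | zero => simpa using h 0
  | succ N => simpa [Finset.sum_range_succ'] using h N

/-- Multiplication by `X` shifts the coefficients and multiplication by `a` preserves their moduli,
so the `ℓ¹` norm at most doubles. Bounding all partial sums avoids any bookkeeping of degrees. -/
lemma sum_norm_coeff_mul_X_sub_C_le {p : Polynomial ℂ} {c : ℝ}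
    (h : ∀ N, ∑ i ∈ Finset.range N, ‖p.coeff i‖ ≤ c) {a : ℂ} (ha : ‖a‖ = 1) (N : ℕ) :
    ∑ i ∈ Finset.range N, ‖(p * (Polynomial.X - Polynomial.C a)).coeff i‖ ≤ 2 * c := by
  calc _ ≤ ∑ i ∈ Finset.range N, (‖(p * Polynomial.X).coeff i‖ + ‖p.coeff i‖) := by
        refine Finset.sum_le_sum fun i _ => ?_
        rw [mul_sub, Polynomial.coeff_sub, Polynomial.coeff_mul_C]
        exact (norm_sub_le _ _).trans_eq (by rw [norm_mul, ha, mul_one])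
    _ ≤ _ := by
        rw [Finset.sum_add_distrib, two_mul]
        exact add_le_add (sum_norm_coeff_mul_X_le h N) (h N)

/-- There is a vector with last entry `1` and with `ℓ¹` norm at most `2 ^ K` which annihilates the
columns of the Vandermonde matrix. -/
lemma exists_annihilator (f : Fin K → ℝ) {m : ℕ} (hm : K ≤ m) :
    ∃ v : ℕ → ℂ, v m = 1 ∧ ∑ r ∈ Finset.range (m + 1), ‖v r‖ ≤ 2 ^ K ∧
      ∀ k, ∑ r ∈ Finset.range (m + 1), v r * node (f k) ^ r = 0 := by
  have hq : ∀ s : Finset (Fin K), ∀ N, ∑ i ∈ Finset.range N,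
      ‖(∏ k ∈ s, (Polynomial.X - Polynomial.C (node (f k)))).coeff i‖ ≤ 2 ^ s.card := by
    classical
    intro s
    induction s using Finset.induction_on with
    | empty =>
      intro N
      simp only [Finset.prod_empty, Polynomial.coeff_one, Finset.card_empty, pow_zero]
      calc _ = ∑ i ∈ Finset.range N, if 0 = i then (1 : ℝ) else 0 :=
            Finset.sum_congr rfl fun i _ => by by_cases h : i = 0 <;> simp [h, eq_comm]
        _ ≤ 1 := by rw [Finset.sum_ite_eq]; split_ifs <;> norm_num
    | insert a s ha ih =>
      intro N
      rw [Finset.prod_insert ha, mul_comm, Finset.card_insert_of_notMem ha, pow_succ, mul_comm (2 ^ _)]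
      exact sum_norm_coeff_mul_X_sub_C_le ih (norm_node _) N
  have hX : ∀ j N, ∑ i ∈ Finset.range N, ‖((∏ k, (Polynomial.X - Polynomial.C (node (f k)))) *
      Polynomial.X ^ j).coeff i‖ ≤ 2 ^ K := by
    intro j
    induction j with
    | zero => simpa using hq Finset.univ
    | succ j ih =>
      intro N
      rw [pow_succ, ← mul_assoc]
      exact sum_norm_coeff_mul_X_le ih N
  -- The factor `X ^ (m - K)` pads the degree to exactly `m`, so that monicity becomes `v m = 1`; it
  -- leaves the `ℓ¹` norm and the vanishing at the nodes intact.
  set q := (∏ k, (Polynomial.X - Polynomial.C (node (f k)))) * Polynomial.X ^ (m - K) with hqdef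
  have hp : (∏ k, (Polynomial.X - Polynomial.C (node (f k)))).Monic :=
    Polynomial.monic_prod_of_monic _ _ fun k _ => Polynomial.monic_X_sub_C _
  have hmon : q.Monic := hp.mul (Polynomial.monic_X_pow _)
  have hdeg : q.natDegree = m := by
    rw [hqdef, hp.natDegree_mul (Polynomial.monic_X_pow _), Polynomial.natDegree_X_pow,
      Polynomial.natDegree_prod_of_monic _ _ fun k _ => Polynomial.monic_X_sub_C _]
    simp
    omega
  refine ⟨q.coeff, ?_, hX _ _, fun k => ?_⟩
  · rw [← hdeg]; exact hmon
  · rw [← hdeg, ← Polynomial.eval_eq_sum_range, hqdef, Polynomial.eval_mul, Polynomial.eval_prod,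
      Finset.prod_eq_zero (Finset.mem_univ k) (by simp), zero_mul]

/-- The annihilator writes the last entry of `A y` as a combination of the others, so Cauchy–Schwarz
bounds it by the truncated vector. No separation of the nodes enters. -/
lemma vecNorm_steeringMatrix_mulVec_le {n : ℕ} (hn : K + 1 ≤ n) (y : Fin K → ℂ) :
    vecNorm (steeringMatrix n f *ᵥ y) ≤ 2 ^ K * vecNorm (dropLastRow (steeringMatrix n f) *ᵥ y) := by
  obtain ⟨m, rfl⟩ : ∃ m, n = m + 1 := ⟨n - 1, by omega⟩
  obtain ⟨v, hv1, hv2, hv3⟩ := exists_annihilator f (show K ≤ m by omega)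
  set w : ℕ → ℂ := fun r => ∑ k, node (f k) ^ r * y k with hw
  have hA : ∀ r : Fin (m + 1), (steeringMatrix (m + 1) f *ᵥ y) r = w r := fun r => rfl
  have hA1 : vecNorm (dropLastRow (steeringMatrix (m + 1) f) *ᵥ y) ^ 2 =
      ∑ r ∈ Finset.range m, ‖w r‖ ^ 2 := by
    rw [vecNorm_sq]
    exact Fin.sum_univ_eq_sum_range (fun r => ‖w r‖ ^ 2) m
  have hA2 : vecNorm (steeringMatrix (m + 1) f *ᵥ y) ^ 2 =
      ∑ r ∈ Finset.range m, ‖w r‖ ^ 2 + ‖w m‖ ^ 2 := by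
    rw [vecNorm_sq, ← Finset.sum_range_succ, ← Fin.sum_univ_eq_sum_range (fun r => ‖w r‖ ^ 2)]
    rfl
  have h0 : ∑ r ∈ Finset.range (m + 1), v r * w r = 0 := by
    simp only [hw, Finset.mul_sum, ← mul_assoc]
    rw [Finset.sum_comm]
    refine Finset.sum_eq_zero fun k _ => ?_
    rw [← Finset.sum_mul, hv3 k, zero_mul]
  rw [Finset.sum_range_succ, hv1, one_mul] at h0
  have hwm : ‖w m‖ ^ 2 ≤ (∑ r ∈ Finset.range m, ‖v r‖ ^ 2) * ∑ r ∈ Finset.range m, ‖w r‖ ^ 2 := by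
    rw [eq_neg_of_add_eq_zero_right h0, norm_neg]
    refine le_trans ?_ (Finset.sum_mul_sq_le_sq_mul_sq _ _ _)
    refine pow_le_pow_left₀ (norm_nonneg _) ((norm_sum_le _ _).trans_eq ?_) 2
    exact Finset.sum_congr rfl fun r _ => norm_mul _ _
  -- The leading coefficient `v m = 1` is already counted in the `ℓ¹` bound, so the extra `1` that
  -- stands for the retained rows is free.
  have hv4 : ∑ r ∈ Finset.range m, ‖v r‖ ^ 2 + 1 ≤ (2 ^ K) ^ 2 := by
    have : ∑ r ∈ Finset.range (m + 1), ‖v r‖ ^ 2 ≤ (∑ r ∈ Finset.range (m + 1), ‖v r‖) ^ 2 :=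
      Finset.sum_sq_le_sq_sum_of_nonneg fun r _ => norm_nonneg _
    rw [Finset.sum_range_succ, hv1, norm_one, one_pow] at this
    exact this.trans (pow_le_pow_left₀ (Finset.sum_nonneg fun r _ => norm_nonneg _) hv2 2)
  refine le_of_sq_le_sq ?_ (mul_nonneg (by positivity) (vecNorm_nonneg _))
  rw [mul_pow, hA1, hA2]
  nlinarith [Finset.sum_nonneg fun r (_ : r ∈ Finset.range m) => sq_nonneg ‖w r‖]

/-- This shift invariance is the reason that ESPRIT recovers the nodes from noiseless data. -/
lemma dropFirstRow_steeringMatrix (n : ℕ) (f : Fin K → ℝ) :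
    dropFirstRow (steeringMatrix n f) = dropLastRow (steeringMatrix n f) * nodeMatrix f := by
  ext i k
  simp [dropFirstRow, dropLastRow, nodeMatrix, steeringMatrix, pow_succ]

lemma norm_nodeMatrix_le (f : Fin K → ℝ) : ‖nodeMatrix f‖ ≤ 1 := by
  rw [nodeMatrix, Matrix.l2_opNorm_diagonal, pi_norm_le_iff_of_nonneg zero_le_one]
  exact fun k => (norm_node _).le

end Steering

/-! ### Perturbation of the signal subspace -/

lemma opNorm_submatrix_rows_le {m n l : ℕ} (A : Matrix (Fin n) (Fin l) ℂ) {e : Fin m → Fin n}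
    (he : Function.Injective e) : ‖A.submatrix e id‖ ≤ ‖A‖ := by
  refine opNorm_le_of_mulVec _ (norm_nonneg _) fun v => ?_
  refine le_trans ?_ (vecNorm_mulVec_le A v)
  refine le_of_sq_le_sq ?_ (vecNorm_nonneg _)
  rw [vecNorm_sq, vecNorm_sq]
  calc ∑ i, ‖(A.submatrix e id *ᵥ v) i‖ ^ 2 = ∑ i, (fun j => ‖(A *ᵥ v) j‖ ^ 2) (e i) := rfl
    _ = ∑ j ∈ Finset.univ.map ⟨e, he⟩, ‖(A *ᵥ v) j‖ ^ 2 := by rw [Finset.sum_map]; rfl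
    _ ≤ _ := Finset.sum_le_sum_of_subset_of_nonneg (Finset.subset_univ _)
        fun _ _ _ => sq_nonneg _

lemma norm_dropLastRow_le {n K : ℕ} (U : Matrix (Fin n) (Fin K) ℂ) : ‖dropLastRow U‖ ≤ ‖U‖ :=
  opNorm_submatrix_rows_le U fun i j h => by simpa [Fin.ext_iff] using h

lemma norm_dropFirstRow_le {n K : ℕ} (U : Matrix (Fin n) (Fin K) ℂ) : ‖dropFirstRow U‖ ≤ ‖U‖ :=
  opNorm_submatrix_rows_le U fun i j h => by simpa [Fin.ext_iff] using h

lemma gap_mul_le {n K : ℕ} (hK : 1 ≤ K) (A : Matrix (Fin n) (Fin K) ℂ)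
    {B : Matrix (Fin K) (Fin K) ℂ} (hB : B.IsHermitian) (hB0 : 0 ≤ eigenvalue K B)
    (hA : 0 < singularValue K A) (y : Fin K → ℂ) :
    singularValue K A ^ 2 * eigenvalue K B * vecNorm (A *ᵥ y) ^ 2 ≤
      (star (A *ᵥ y) ⬝ᵥ ((A * B * Aᴴ) *ᵥ (A *ᵥ y))).re := by
  set x := A *ᵥ y with hx
  -- `Aᴴ` is bounded below on the range of `A`: `‖x‖² = ⟨y, Aᴴ x⟩ ≤ ‖y‖ ‖Aᴴ x‖`, while `σ_K(A) ‖y‖ ≤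
  -- ‖x‖`.
  have h1 : singularValue K A * vecNorm x ≤ vecNorm (Aᴴ *ᵥ x) := by
    rcases (vecNorm_nonneg x).eq_or_lt with h | h
    · rw [← h, mul_zero]; exact vecNorm_nonneg _
    have h2 := norm_star_dotProduct_le y (Aᴴ *ᵥ x)
    rw [← mulVec_star_dotProduct, ← hx, star_dotProduct_self, Complex.norm_real, Real.norm_eq_abs,
      abs_of_nonneg (sq_nonneg _)] at h2
    have h3 := singularValue_mul_vecNorm_le hK A y
    rw [← hx] at h3
    have h4 := mul_le_mul_of_nonneg_right h3 (vecNorm_nonneg (Aᴴ *ᵥ x))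
    have h5 := mul_le_mul_of_nonneg_left h2 hA.le
    nlinarith
  have h2 := eigenvalue_mul_le hK hB (Aᴴ *ᵥ x)
  rw [mulVec_star_dotProduct, Matrix.conjTranspose_conjTranspose] at h2
  rw [← Matrix.mulVec_mulVec, ← Matrix.mulVec_mulVec]
  refine le_trans ?_ h2
  have h3 := pow_le_pow_left₀ (mul_nonneg hA.le (vecNorm_nonneg x)) h1 2
  rw [mul_pow] at h3
  nlinarith

lemma IsLeadingEigenbasis.isometry {n K : ℕ} {hKn : K ≤ n} {R : Matrix (Fin n) (Fin n) ℂ}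
    {U : Matrix (Fin n) (Fin K) ℂ} (hU : IsLeadingEigenbasis hKn R U) : Uᴴ * U = 1 := by
  obtain ⟨V, d, hV, -, -, rfl⟩ := hU
  have h : Vᴴ * V = 1 := Matrix.mem_unitaryGroup_iff'.1 hV
  rw [Matrix.conjTranspose_submatrix]
  change (Vᴴ * V).submatrix _ _ = 1
  rw [h]
  exact Matrix.submatrix_one _ (Fin.castLE_injective hKn)

/-- The leading eigenvectors of a perturbation of `A B Aᴴ + t` almost lie in the range of `A`. -/
lemma IsLeadingEigenbasis.exists_approx {n K : ℕ} (hK : 1 ≤ K) {hKn : K ≤ n}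
    {A : Matrix (Fin n) (Fin K) ℂ} {B : Matrix (Fin K) (Fin K) ℂ} {R D : Matrix (Fin n) (Fin n) ℂ}
    {U : Matrix (Fin n) (Fin K) ℂ} {t γ δ : ℝ} (hR : R = A * B * Aᴴ + (t : ℂ) • 1 + D)
    (hD : ‖D‖ ≤ δ) (hA : ∀ y, A *ᵥ y = 0 → y = 0)
    (hγ : ∀ y, γ * vecNorm (A *ᵥ y) ^ 2 ≤ (star (A *ᵥ y) ⬝ᵥ ((A * B * Aᴴ) *ᵥ (A *ᵥ y))).re)
    (hδγ : δ < γ) (hU : IsLeadingEigenbasis hKn R U) :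
    ∃ G : Matrix (Fin K) (Fin K) ℂ, ‖U - A * G‖ ≤ δ / (γ - δ) := by
  have hiso := hU.isometry
  obtain ⟨V, d, hV, hd, hRV, hUV⟩ := hU
  have hVV : Vᴴ * V = 1 := Matrix.mem_unitaryGroup_iff'.1 hV
  have hVV' : V * Vᴴ = 1 := Matrix.mem_unitaryGroup_iff.1 hV
  set l : Fin n := ⟨K - 1, by omega⟩ with hl
  -- the `K`-th eigenvalue is at least `γ - δ`
  have hlow : γ - δ ≤ d l - t := by
    -- Dimension count: orthogonality to the first `K - 1` eigenvectors imposes `K - 1` linear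
    -- conditions on `y`, which has `K` coordinates. At such an `x = A y` the form of `R` is at most
    -- `d l ‖x‖²`.
    obtain ⟨y, hy0, hy⟩ : ∃ y : Fin K → ℂ, y ≠ 0 ∧
        ∀ i : Fin (K - 1), (Vᴴ *ᵥ (A *ᵥ y)) ⟨i, by omega⟩ = 0 := by
      let T : (Fin K → ℂ) →ₗ[ℂ] (Fin (K - 1) → ℂ) :=
        Matrix.mulVecLin ((Vᴴ * A).submatrix (fun i : Fin (K - 1) => (⟨i, by omega⟩ : Fin n)) id)
      obtain ⟨y, hy, hy0⟩ := (Submodule.ne_bot_iff _).1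
        (LinearMap.ker_ne_bot_of_finrank_lt (f := T) (by simp; omega))
      refine ⟨y, hy0, fun i => ?_⟩
      rw [Matrix.mulVec_mulVec]
      exact congrFun (LinearMap.mem_ker.1 hy) i
    set x := A *ᵥ y with hx
    have hx0 : 0 < vecNorm x := vecNorm_pos fun h => hy0 (hA y h)
    have hVx : vecNorm (Vᴴ *ᵥ x) = vecNorm x :=
      vecNorm_mulVec_of_isometry (by rwa [Matrix.conjTranspose_conjTranspose]) x
    have hup : (star x ⬝ᵥ (R *ᵥ x)).re ≤ d l * vecNorm x ^ 2 := by
      have h1 : star x ⬝ᵥ (R *ᵥ x) = ((∑ i, d i * ‖(Vᴴ *ᵥ x) i‖ ^ 2 : ℝ) : ℂ) := by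
        rw [hRV, ← Matrix.mulVec_mulVec, ← Matrix.mulVec_mulVec]
        conv_lhs => rw [← Matrix.conjTranspose_conjTranspose V, ← mulVec_star_dotProduct]
        rw [Matrix.conjTranspose_conjTranspose]
        simp only [dotProduct, Matrix.mulVec_diagonal, Pi.star_apply, Complex.ofReal_sum]
        refine Finset.sum_congr rfl fun i _ => ?_
        rw [mul_left_comm, RCLike.star_def, Complex.conj_mul']
        push_cast
        rfl
      rw [h1, Complex.ofReal_re, ← hVx, vecNorm_sq, Finset.mul_sum]
      refine Finset.sum_le_sum fun i _ => ?_
      by_cases hi : i.1 < K - 1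
      · have : (Vᴴ *ᵥ x) i = 0 := hy ⟨i, hi⟩
        simp [this]
      · exact mul_le_mul_of_nonneg_right (hd (by rw [Fin.le_def]; simp [hl]; omega)) (sq_nonneg _)
    have hdown : (γ + t - δ) * vecNorm x ^ 2 ≤ (star x ⬝ᵥ (R *ᵥ x)).re := by
      rw [hR, Matrix.add_mulVec, Matrix.add_mulVec, dotProduct_add, dotProduct_add,
        Matrix.smul_mulVec, Matrix.one_mulVec, dotProduct_smul, star_dotProduct_self]
      have h1 := hγ y
      have h2 : -(δ * vecNorm x ^ 2) ≤ (star x ⬝ᵥ (D *ᵥ x)).re := by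
        refine neg_le_of_abs_le ((Complex.abs_re_le_norm _).trans ?_)
        refine (norm_star_dotProduct_le _ _).trans ?_
        have h3 := (vecNorm_mulVec_le D x).trans (mul_le_mul_of_nonneg_right hD (vecNorm_nonneg x))
        nlinarith [vecNorm_nonneg x]
      have h3 : ((t : ℂ) • ((vecNorm x ^ 2 : ℝ) : ℂ)).re = t * vecNorm x ^ 2 := by
        rw [smul_eq_mul, ← Complex.ofReal_mul, Complex.ofReal_re]
      rw [Complex.add_re, Complex.add_re, h3]
      linarith
    have := le_of_mul_le_mul_right (hdown.trans hup) (by positivity)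
    linarith
  have hpos : 0 < γ - δ := sub_pos.2 hδγ
  set e : Fin K → ℂ := fun k => ((d (Fin.castLE hKn k) - t : ℝ) : ℂ) with he
  have hek : ∀ k, γ - δ ≤ d (Fin.castLE hKn k) - t := fun k =>
    hlow.trans (sub_le_sub_right (hd (by rw [Fin.le_def]; simp [hl]; omega)) _)
  have hRU : (A * B * Aᴴ + D) * U = U * Matrix.diagonal e := by
    have h1 : R * V = V * Matrix.diagonal (fun i => (d i : ℂ)) := by
      rw [hRV, Matrix.mul_assoc, hVV, Matrix.mul_one]
    have h2 : R * U = U * Matrix.diagonal (fun k => (d (Fin.castLE hKn k) : ℂ)) := by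
      ext i k
      have := congrFun (congrFun h1 i) (Fin.castLE hKn k)
      rw [Matrix.mul_diagonal] at this ⊢
      rw [hUV]
      exact this
    have h3 : A * B * Aᴴ + D = R - (t : ℂ) • 1 := by rw [hR]; abel
    rw [h3, Matrix.sub_mul, h2]
    ext i k
    rw [Matrix.sub_apply, Matrix.mul_diagonal, Matrix.mul_diagonal, he]
    simp
    ring
  set e' : Fin K → ℂ := fun k => (e k)⁻¹ with he'
  have hee : Matrix.diagonal e * Matrix.diagonal e' = 1 := by
    rw [Matrix.diagonal_mul_diagonal, ← Matrix.diagonal_one]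
    congr 1
    ext k
    exact mul_inv_cancel₀ (by simp only [he]; exact_mod_cast (hpos.trans_le (hek k)).ne')
  -- With `Λ` the leading eigenvalues less the noise floor, `(A B Aᴴ + D) U = U Λ` gives `U = A (B
  -- Aᴴ U Λ⁻¹) + D U Λ⁻¹`. The first term is in the range of `A`; the second is bounded by `δ / (γ -
  -- δ)`.
  refine ⟨B * Aᴴ * U * Matrix.diagonal e', ?_⟩
  have h4 : U - A * (B * Aᴴ * U * Matrix.diagonal e') = D * (U * Matrix.diagonal e') := by
    have : U = (A * B * Aᴴ + D) * U * Matrix.diagonal e' := by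
      rw [hRU, Matrix.mul_assoc, hee, Matrix.mul_one]
    nth_rewrite 1 [this]
    simp only [Matrix.add_mul, Matrix.mul_assoc]
    abel
  have hU1 : ‖U‖ ≤ 1 := opNorm_le_of_mulVec _ zero_le_one fun v => by
    rw [vecNorm_mulVec_of_isometry hiso, one_mul]
  have he1 : ‖Matrix.diagonal e'‖ ≤ (γ - δ)⁻¹ := by
    rw [Matrix.l2_opNorm_diagonal, pi_norm_le_iff_of_nonneg (inv_nonneg.2 hpos.le)]
    intro k
    rw [he', norm_inv, he]
    simp only [Complex.norm_real, Real.norm_eq_abs]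
    exact inv_anti₀ hpos ((hek k).trans (le_abs_self _))
  rw [h4, div_eq_mul_inv]
  refine (Matrix.l2_opNorm_mul _ _).trans (mul_le_mul hD ?_ (norm_nonneg _) ((norm_nonneg _).trans hD))
  refine (Matrix.l2_opNorm_mul _ _).trans ?_
  nlinarith [norm_nonneg U, norm_nonneg (Matrix.diagonal e')]

/-! ### Eigenvalues of perturbed diagonal matrices -/

section Matching

variable {K : ℕ}

/-- The Bauer–Fike theorem for a diagonal matrix. -/
lemma exists_norm_sub_le_of_root {z : Fin K → ℂ} {F : Matrix (Fin K) (Fin K) ℂ} {x : ℂ}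
    (hx : (Matrix.diagonal z + F).charpoly.eval x = 0) : ∃ k, ‖x - z k‖ ≤ ‖F‖ := by
  rw [Matrix.eval_charpoly] at hx
  obtain ⟨v, hv0, hv⟩ := Matrix.exists_mulVec_eq_zero_iff.2 hx
  have hF : F *ᵥ v = fun k => (x - z k) * v k := by
    ext k
    have := congrFun hv k
    rw [Matrix.sub_mulVec, Matrix.add_mulVec, Matrix.scalar_apply, Pi.sub_apply, Pi.add_apply,
      Matrix.mulVec_diagonal, Matrix.mulVec_diagonal, Pi.zero_apply] at this
    linear_combination -this
  obtain ⟨k₁, hk₁⟩ := Function.ne_iff.1 hv0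
  -- For an eigenvector `v`, the vector `F v` has entries `(x - z j) v j`; the node nearest to `x`
  -- bounds all the factors from below.
  obtain ⟨k, -, hk⟩ := Finset.exists_min_image Finset.univ (fun k => ‖x - z k‖) ⟨k₁, Finset.mem_univ _⟩
  refine ⟨k, le_of_mul_le_mul_right (le_trans ?_ (vecNorm_mulVec_le F v)) (vecNorm_pos hv0)⟩
  refine le_of_sq_le_sq ?_ (vecNorm_nonneg _)
  rw [mul_pow, vecNorm_sq, vecNorm_sq, hF, Finset.mul_sum]
  refine Finset.sum_le_sum fun j _ => ?_
  rw [norm_mul, mul_pow]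
  exact mul_le_mul_of_nonneg_right (pow_le_pow_left₀ (norm_nonneg _) (hk j (Finset.mem_univ _)) 2)
    (sq_nonneg _)

lemma map_eq_map_of_prod_X_sub_C_eq {v w : Fin K → ℂ}
    (h : ∏ k, (Polynomial.X - Polynomial.C (v k)) = ∏ k, (Polynomial.X - Polynomial.C (w k))) :
    Finset.univ.val.map v = Finset.univ.val.map w := by
  have hr : ∀ u : Fin K → ℂ, (∏ k, (Polynomial.X - Polynomial.C (u k))).roots =
      Finset.univ.val.map u := fun u => by
    rw [← Polynomial.roots_multiset_prod_X_sub_C (Finset.univ.val.map u), Multiset.map_map]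
    rfl
  rw [← hr, ← hr, h]

/-- The closed `r`-neighbourhood of the points `z i`, `i ∈ C`. -/
def pointNhd (z : Fin K → ℂ) (r : ℝ) (C : Finset (Fin K)) : Set ℂ :=
  ⋃ i ∈ C, Metric.closedBall (z i) r

lemma isCompact_pointNhd (z : Fin K → ℂ) (r : ℝ) (C : Finset (Fin K)) :
    IsCompact (pointNhd z r C) :=
  C.isCompact_biUnion fun i _ => isCompact_closedBall (z i) r

lemma mem_pointNhd {z : Fin K → ℂ} {r : ℝ} {C : Finset (Fin K)} {x : ℂ} :
    x ∈ pointNhd z r C ↔ ∃ i ∈ C, ‖x - z i‖ ≤ r := by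
  simp [pointNhd, dist_eq_norm]

open Classical in
/-- A cluster of diagonal entries which is separated from the others attracts as many eigenvalues
of the perturbed matrix as it has members. -/
lemma card_eigenvalues_near_cluster {z : Fin K → ℂ} {F : Matrix (Fin K) (Fin K) ℂ}
    {w : Fin K → ℂ}
    (hw : (Matrix.diagonal z + F).charpoly = ∏ k, (Polynomial.X - Polynomial.C (w k)))
    {C : Finset (Fin K)} (hC : ∀ i ∈ C, ∀ j ∉ C, 2 * ‖F‖ < ‖z i - z j‖) :
    (Finset.univ.filter fun k => w k ∈ pointNhd z ‖F‖ C).card = C.card := by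
  set S := pointNhd z ‖F‖ C with hS
  set S' := pointNhd z ‖F‖ Cᶜ with hS'
  have hdisj : ∀ x ∈ S, x ∉ S' := by
    intro x hx hx'
    obtain ⟨i, hi, h1⟩ := mem_pointNhd.1 hx
    obtain ⟨j, hj, h2⟩ := mem_pointNhd.1 hx'
    have h3 := hC i hi j (Finset.mem_compl.1 hj)
    have h4 : ‖z i - z j‖ ≤ ‖x - z i‖ + ‖x - z j‖ := by
      rw [show z i - z j = (x - z j) - (x - z i) by ring]
      exact (norm_sub_le _ _).trans_eq (add_comm _ _)
    linarith
  -- Homotopy from the diagonal matrix at `t = 0` to the perturbed one at `t = 1`. By Bauer–Fike its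
  -- roots never leave the disjoint compact sets `S` and `S'`.
  let p : ℝ → Polynomial ℂ := fun t => (Matrix.diagonal z + (t : ℂ) • F).charpoly
  have hroot : ∀ t ∈ Set.Icc (0 : ℝ) 1, ∀ u : Fin K → ℂ,
      p t = ∏ k, (Polynomial.X - Polynomial.C (u k)) → ∀ k, u k ∈ S ∨ u k ∈ S' := by
    intro t ht u hu k
    have h0 : (p t).eval (u k) = 0 := by
      rw [hu, Polynomial.eval_prod, Finset.prod_eq_zero (Finset.mem_univ k)]
      simp
    obtain ⟨i, hi⟩ := exists_norm_sub_le_of_root h0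
    have hi' : ‖u k - z i‖ ≤ ‖F‖ := by
      refine hi.trans ?_
      rw [norm_smul, Complex.norm_real, Real.norm_eq_abs, abs_of_nonneg ht.1]
      exact mul_le_of_le_one_left (norm_nonneg _) ht.2
    by_cases h : i ∈ C
    · exact Or.inl (mem_pointNhd.2 ⟨i, h, hi'⟩)
    · exact Or.inr (mem_pointNhd.2 ⟨i, Finset.mem_compl.2 h, hi'⟩)
  -- The times at which some listing of the roots has in `S` exactly the entries with index in `J`.
  -- The cardinality of `J` is then the number of roots in `S`, whatever the listing. Closedness of
  -- these sets takes the place of continuity of the roots.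
  let T : Finset (Fin K) → Set ℝ := fun J => {t | t ∈ Set.Icc (0 : ℝ) 1 ∧ ∃ u : Fin K → ℂ,
    p t = ∏ k, (Polynomial.X - Polynomial.C (u k)) ∧ ∀ k, u k ∈ if k ∈ J then S else S'}
  have hTclosed : ∀ J, IsClosed (T J) := by
    intro J
    let E : Set (ℝ × (Fin K → ℂ)) :=
      {q | p q.1 = ∏ k, (Polynomial.X - Polynomial.C (q.2 k))}
    have hE : IsClosed E := by
      have : E = ⋂ x : ℂ, {q | (Matrix.scalar (Fin K) x -
          (Matrix.diagonal z + (q.1 : ℂ) • F)).det = ∏ k, (x - q.2 k)} := by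
        ext q
        simp only [E, Set.mem_ofPred_eq, Set.mem_iInter]
        constructor
        · intro h x
          have := congrArg (Polynomial.eval x) h
          simpa [p, Matrix.eval_charpoly, Polynomial.eval_prod] using this
        · intro h
          refine Polynomial.funext fun x => ?_
          simpa [p, Matrix.eval_charpoly, Polynomial.eval_prod] using h x
      rw [this]
      refine isClosed_iInter fun x => isClosed_eq ?_ ?_
      · refine Continuous.matrix_det ?_
        fun_prop
      · fun_prop
    -- The pairs of a time and a listing of roots in the prescribed compact sets form a compact set,
    -- whose projection to the time axis is `T J`.
    have hcomp : IsCompact ((Set.Icc (0 : ℝ) 1 ×ˢ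
        Set.univ.pi fun k => if k ∈ J then S else S') ∩ E) := by
      refine (isCompact_Icc.prod (isCompact_univ_pi fun k => ?_)).inter_right hE
      split_ifs
      exacts [isCompact_pointNhd _ _ _, isCompact_pointNhd _ _ _]
    have hTJ : T J = Prod.fst '' ((Set.Icc (0 : ℝ) 1 ×ˢ
        Set.univ.pi fun k => if k ∈ J then S else S') ∩ E) := by
      ext t
      constructor
      · rintro ⟨ht, u, hu, huJ⟩
        exact ⟨(t, u), ⟨⟨ht, fun k _ => huJ k⟩, hu⟩, rfl⟩
      · rintro ⟨⟨t', u⟩, ⟨⟨ht, huJ⟩, hu⟩, rfl⟩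
        exact ⟨ht, u, hu, fun k => huJ k (Set.mem_univ k)⟩
    rw [hTJ]
    exact (hcomp.image continuous_fst).isClosed
  have hcard : ∀ (J : Finset (Fin K)) (u : Fin K → ℂ), (∀ k, u k ∈ if k ∈ J then S else S') →
      (Finset.univ.val.map u).countP (· ∈ S) = J.card := by
    intro J u hu
    rw [Multiset.countP_map, ← Finset.filter_val, Finset.card_val]
    congr 1
    ext k
    rw [Finset.mem_filter]
    constructor
    · rintro ⟨-, hk⟩
      by_contra hkJ
      have := hu k
      rw [if_neg hkJ] at this
      exact hdisj _ hk this
    · intro hkJ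
      have := hu k
      rw [if_pos hkJ] at this
      exact ⟨Finset.mem_univ _, this⟩
  have huniq : ∀ (t : ℝ) (J J' : Finset (Fin K)), t ∈ T J → t ∈ T J' → J.card = J'.card := by
    rintro t J J' ⟨-, u, hu, huJ⟩ ⟨-, u', hu', huJ'⟩
    rw [← hcard J u huJ, ← hcard J' u' huJ',
      map_eq_map_of_prod_X_sub_C_eq (hu.symm.trans hu')]
  have hmem : ∀ t ∈ Set.Icc (0 : ℝ) 1, ∀ u : Fin K → ℂ,
      p t = ∏ k, (Polynomial.X - Polynomial.C (u k)) →
      t ∈ T (Finset.univ.filter fun k => u k ∈ S) := by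
    intro t ht u hu
    refine ⟨ht, u, hu, fun k => ?_⟩
    simp only [Finset.mem_filter, Finset.mem_univ, true_and]
    split_ifs with h
    exacts [h, (hroot t ht u hu k).resolve_left h]
  have hsplit : ∀ t, ∃ u : Fin K → ℂ, p t = ∏ k, (Polynomial.X - Polynomial.C (u k)) := by
    intro t
    have hm : (p t).Monic := Matrix.charpoly_monic _
    have hs := (IsAlgClosed.splits (p t)).eq_prod_roots_of_monic hm
    have hc : (p t).roots.card = K := by
      rw [IsAlgClosed.card_roots_eq_natDegree, Matrix.charpoly_natDegree_eq_dim, Fintype.card_fin]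
    obtain ⟨l, hl⟩ := Quot.exists_rep (p t).roots
    have hl' : (l : Multiset ℂ) = (p t).roots := hl
    have hlen : l.length = K := by rw [← hc, ← hl', Multiset.coe_card]
    subst hlen
    refine ⟨fun k => l.get k, ?_⟩
    rw [hs, ← hl', Multiset.map_coe, Multiset.prod_coe, ← List.prod_ofFn]
    congr 1
    refine List.ext_get (by simp) fun n h1 h2 => by simp
  -- If the count at `t = 1` differed from that at `t = 0`, the closed sets of times with the right
  -- and with a wrong count would both be nonempty and cover the connected interval, hence share a
  -- time, against `huniq`.
  set T₀ := ⋃ J ∈ Finset.univ.filter (fun J : Finset (Fin K) => J.card = C.card), T J with hT₀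
  set T₁ := ⋃ J ∈ Finset.univ.filter (fun J : Finset (Fin K) => J.card ≠ C.card), T J with hT₁
  have h0 : (0 : ℝ) ∈ T C := by
    refine ⟨by simp, z, by simp [p, Matrix.charpoly_diagonal], fun k => ?_⟩
    split_ifs with h
    · exact mem_pointNhd.2 ⟨k, h, by simp⟩
    · exact mem_pointNhd.2 ⟨k, Finset.mem_compl.2 h, by simp⟩
  have h1 := hmem 1 (by simp) w (by simpa [p] using hw)
  by_contra hne
  have hcl := isPreconnected_closed_iff.1 (isPreconnected_Icc (a := (0 : ℝ)) (b := 1)) T₀ T₁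
    (isClosed_biUnion_finset fun J _ => hTclosed J) (isClosed_biUnion_finset fun J _ => hTclosed J)
    (by
      intro t ht
      obtain ⟨u, hu⟩ := hsplit t
      have := hmem t ht u hu
      by_cases h : (Finset.univ.filter fun k => u k ∈ S).card = C.card
      · exact Or.inl (Set.mem_biUnion (by simpa using h) this)
      · exact Or.inr (Set.mem_biUnion (by simpa using h) this))
    ⟨0, by simp, Set.mem_biUnion (by simp) h0⟩
    ⟨1, by simp, Set.mem_biUnion (by simpa using hne) h1⟩
  obtain ⟨t, -, ht0, ht1⟩ := hcl
  obtain ⟨J, hJ, htJ⟩ := Set.mem_iUnion₂.1 ht0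
  obtain ⟨J', hJ', htJ'⟩ := Set.mem_iUnion₂.1 ht1
  exact (Finset.mem_filter.1 hJ').2
    ((huniq t J' J htJ' htJ).trans (Finset.mem_filter.1 hJ).2)

/-- Two entries are adjacent if they are at distance at most `r`. -/
def nearGraph (z : Fin K → ℂ) (r : ℝ) : SimpleGraph (Fin K) where
  Adj i j := i ≠ j ∧ ‖z i - z j‖ ≤ r
  symm := ⟨fun i j h => ⟨h.1.symm, by rw [norm_sub_rev]; exact h.2⟩⟩
  loopless := ⟨fun i h => h.1 rfl⟩

lemma norm_sub_le_of_walk {z : Fin K → ℂ} {r : ℝ} {i j : Fin K} (p : (nearGraph z r).Walk i j) :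
    ‖z i - z j‖ ≤ p.length * r := by
  induction p with
  | nil => simp
  | @cons u v w h p ih =>
    rw [SimpleGraph.Walk.length_cons]
    push_cast
    have := norm_sub_le_norm_sub_add_norm_sub (z u) (z v) (z w)
    linarith [h.2]

/-- The eigenvalues of a perturbed diagonal matrix can be matched with the diagonal entries. -/
theorem exists_perm_norm_sub_le {z : Fin K → ℂ} {F : Matrix (Fin K) (Fin K) ℂ} {w : Fin K → ℂ}
    (hw : (Matrix.diagonal z + F).charpoly = ∏ k, (Polynomial.X - Polynomial.C (w k))) :
    ∃ ψ : Equiv.Perm (Fin K), ∀ k, ‖w (ψ k) - z k‖ ≤ 2 * K * ‖F‖ := by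
  classical
  set H := nearGraph z (2 * ‖F‖) with hH
  have hroot : ∀ k, ∃ i, ‖w k - z i‖ ≤ ‖F‖ := fun k => exists_norm_sub_le_of_root (F := F) (by
    rw [hw, Polynomial.eval_prod, Finset.prod_eq_zero (Finset.mem_univ k)]
    simp)
  choose τ hτ using hroot
  have hcomp : ∀ {i j}, ‖z i - z j‖ ≤ 2 * ‖F‖ → H.connectedComponentMk i = H.connectedComponentMk j := by
    intro i j hij
    by_cases h : i = j
    · rw [h]
    · exact SimpleGraph.ConnectedComponent.sound (SimpleGraph.Adj.reachable ⟨h, hij⟩)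
  -- Distinct components are more than `2 ‖F‖` apart, so the cluster count applies to each.
  -- Whichever node within `‖F‖` of an eigenvalue is chosen as `τ`, its component is the same.
  have hfib : ∀ c : H.ConnectedComponent,
      Nonempty ({k // H.connectedComponentMk k = c} ≃ {k // H.connectedComponentMk (τ k) = c}) := by
    intro c
    set C := Finset.univ.filter fun k => H.connectedComponentMk k = c with hCdef
    have hcard := card_eigenvalues_near_cluster hw (C := C) (fun i hi j hj => by
      by_contra! h
      simp only [hCdef, Finset.mem_filter, Finset.mem_univ, true_and] at hi hj
      exact hj ((hcomp h).symm.trans hi))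
    refine ⟨Fintype.equivOfCardEq ?_⟩
    rw [Fintype.card_subtype, Fintype.card_subtype, ← hcard]
    congr 1
    ext k
    simp only [Finset.mem_filter, Finset.mem_univ, true_and, mem_pointNhd, hCdef]
    constructor
    · rintro ⟨i, hi, hik⟩
      rw [← hi]
      refine hcomp ?_
      have := norm_sub_le (w k - z i) (w k - z (τ k))
      rw [sub_sub_sub_cancel_left] at this
      linarith [hτ k]
    · intro h
      exact ⟨τ k, h, hτ k⟩
  let ψ : Equiv.Perm (Fin K) := Equiv.ofFiberEquiv (f := fun k => H.connectedComponentMk k)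
    (g := fun k => H.connectedComponentMk (τ k)) fun c => (hfib c).some
  refine ⟨ψ, fun k => ?_⟩
  have hψ : H.connectedComponentMk (τ (ψ k)) = H.connectedComponentMk k :=
    Equiv.ofFiberEquiv_map (f := fun k => H.connectedComponentMk k)
      (g := fun k => H.connectedComponentMk (τ k)) _ k
  obtain ⟨q⟩ := SimpleGraph.ConnectedComponent.exact hψ
  -- A path has at most `K - 1` edges, each of length at most `2 ‖F‖`; the step from the eigenvalue
  -- to `z (τ (ψ k))` adds `‖F‖`, in total at most `(2K - 1) ‖F‖`.
  have h1 := norm_sub_le_of_walk (q.toPath : H.Walk (τ (ψ k)) k)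
  have h2 : ((q.toPath : H.Walk (τ (ψ k)) k).length : ℝ) + 1 ≤ K := by
    have := q.toPath.2.length_lt
    rw [Fintype.card_fin] at this
    exact_mod_cast this
  have h3 := norm_sub_le_norm_sub_add_norm_sub (w (ψ k)) (z (τ (ψ k))) (z k)
  have h4 := hτ (ψ k)
  nlinarith [norm_nonneg F]

end Matching

/-! ### Perturbation of the ESPRIT estimates -/

section Estimate

variable {K : ℕ}

lemma matchedDist_le (hK : 1 ≤ K) {g f : Fin K → ℝ} {c : ℝ} (ψ : Equiv.Perm (Fin K))
    (h : ∀ k, min |g (ψ k) - f k| (1 - |g (ψ k) - f k|) ≤ c) : matchedDist g f ≤ c := by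
  have : Nonempty (Fin K) := ⟨⟨0, hK⟩⟩
  exact (ciInf_le (Set.finite_range _).bddBelow ψ).trans (ciSup_le h)

lemma matchedDist_le_half (hK : 1 ≤ K) (g f : Fin K → ℝ) : matchedDist g f ≤ 1 / 2 := by
  refine matchedDist_le hK 1 fun k => ?_
  rcases le_total |g k - f k| (1 / 2) with h | h
  · exact (min_le_left _ _).trans h
  · refine (min_le_right _ _).trans ?_
    simp only [Equiv.Perm.coe_one, id_eq]
    linarith

/-- Radial projection moves `z` by its distance to the unit circle, which is at most `‖z - node b‖`.
Hence the chord from `node a` to `node b` is at most twice that. The argument covers `z = 0` with an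
arbitrary angle. -/
lemma wrapDist_le_half_norm {a b : ℝ} {z : ℂ} (ha : a ∈ Set.Ico (0 : ℝ) 1)
    (hb : b ∈ Set.Ico (0 : ℝ) 1) (hz : z = (‖z‖ : ℂ) * node a) :
    min |a - b| (1 - |a - b|) ≤ ‖z - node b‖ / 2 := by
  have h1 := four_mul_wrapDist_le ha hb
  have h2 : ‖node a - z‖ ≤ ‖z - node b‖ := by
    have h3 : node a - z = ((1 - ‖z‖ : ℝ) : ℂ) * node a := by
      nth_rewrite 1 [hz]
      push_cast
      ring
    rw [h3, norm_mul, norm_node, mul_one, Complex.norm_real, Real.norm_eq_abs, ← norm_node b,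
      norm_sub_rev]
    exact abs_norm_sub_norm_le _ _
  have h4 := norm_sub_le_norm_sub_add_norm_sub (node a) z (node b)
  linarith

/-- Injectivity of `A` turns `A X A = A` into `X A = 1`. Since `A X` is an orthogonal projection, `τ
‖X w‖ ≤ ‖A X w‖ ≤ ‖w‖`. -/
lemma IsPseudoInverse.norm_le_inv {m n : ℕ} {A : Matrix (Fin m) (Fin n) ℂ}
    {X : Matrix (Fin n) (Fin m) ℂ} (hX : IsPseudoInverse A X) {τ : ℝ} (hτ : 0 < τ)
    (hA : ∀ y, τ * vecNorm y ≤ vecNorm (A *ᵥ y)) : X * A = 1 ∧ ‖X‖ ≤ τ⁻¹ := by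
  have hinj : ∀ y, A *ᵥ y = 0 → y = 0 := fun y hy => by
    have := hA y
    rw [hy, vecNorm_zero] at this
    exact vecNorm_eq_zero.1 (le_antisymm (nonpos_of_mul_nonpos_right this hτ) (vecNorm_nonneg y))
  constructor
  · refine Matrix.ext_of_mulVec_single fun i => ?_
    rw [← sub_eq_zero, ← Matrix.sub_mulVec]
    refine hinj _ ?_
    rw [Matrix.mulVec_mulVec, Matrix.mul_sub, ← Matrix.mul_assoc, hX.mul_mul_self, Matrix.mul_one,
      sub_self, Matrix.zero_mulVec]
  · refine opNorm_le_of_mulVec _ (inv_nonneg.2 hτ.le) fun w => ?_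
    have h1 : vecNorm (A *ᵥ (X *ᵥ w)) ≤ vecNorm w := by
      set v := A *ᵥ (X *ᵥ w) with hv
      have h2 : star v ⬝ᵥ v = star v ⬝ᵥ w := by
        have h3 : (A * X)ᴴ * (A * X) = (A * X)ᴴ := by
          rw [hX.isHermitian_left, ← Matrix.mul_assoc, hX.mul_mul_self]
        rw [hv, Matrix.mulVec_mulVec, mulVec_star_dotProduct, Matrix.mulVec_mulVec, h3,
          mulVec_star_dotProduct]
      have h3 := norm_star_dotProduct_le v w
      rw [← h2, star_dotProduct_self, Complex.norm_real, Real.norm_eq_abs,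
        abs_of_nonneg (sq_nonneg _), sq] at h3
      rcases (vecNorm_nonneg v).eq_or_lt with h | h
      · rw [← h]; exact vecNorm_nonneg w
      · exact le_of_mul_le_mul_left h3 h
    have h2 := (hA (X *ᵥ w)).trans h1
    rw [inv_mul_eq_div, le_div_iff₀ hτ, mul_comm]
    exact h2

/-- If `U` is close to the range of the Vandermonde matrix, then `U₁^† U₂` is similar to a small
perturbation of the diagonal matrix of the nodes. -/
lemma exists_similar_perturbation {n : ℕ} (hn : K + 1 ≤ n) (f : Fin K → ℝ)
    {U : Matrix (Fin n) (Fin K) ℂ} (hU : Uᴴ * U = 1) {X : Matrix (Fin K) (Fin (n - 1)) ℂ}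
    (hX : IsPseudoInverse (dropLastRow U) X) {G : Matrix (Fin K) (Fin K) ℂ} {s c : ℝ}
    (hG : ‖U - steeringMatrix n f * G‖ ≤ s) (hs : 2 ^ K * s ≤ 1 / 32) (hs1 : s ≤ 1 / 32)
    (hc : 0 < c) (hA : ∀ y, c * vecNorm y ≤ vecNorm (steeringMatrix n f *ᵥ y)) :
    ∃ F : Matrix (Fin K) (Fin K) ℂ,
      (X * dropFirstRow U).charpoly = (nodeMatrix f + F).charpoly ∧
      ‖F‖ ≤ 8 * 2 ^ K * s * ‖steeringMatrix n f‖ / c := by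
  set A := steeringMatrix n f with hAdef
  set b : ℝ := 2 ^ K with hb
  have hb0 : 0 < b := by positivity
  have hs0 : 0 ≤ s := (norm_nonneg _).trans hG
  set D := U - A * G with hD
  have hUD : U = A * G + D := by rw [hD]; abel
  have hDx : ∀ x, vecNorm (D *ᵥ x) ≤ s * vecNorm x := fun x =>
    (vecNorm_mulVec_le D x).trans (mul_le_mul_of_nonneg_right hG (vecNorm_nonneg x))
  have hUx := vecNorm_mulVec_of_isometry hU
  have hAGl : ∀ x, (1 - s) * vecNorm x ≤ vecNorm (A *ᵥ (G *ᵥ x)) := fun x => by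
    have h1 : U *ᵥ x = A *ᵥ (G *ᵥ x) + D *ᵥ x := by
      rw [Matrix.mulVec_mulVec, ← Matrix.add_mulVec, ← hUD]
    have h2 := vecNorm_add_le (A *ᵥ (G *ᵥ x)) (D *ᵥ x)
    rw [← h1, hUx] at h2
    linarith [hDx x]
  have hAGu : ∀ x, vecNorm (A *ᵥ (G *ᵥ x)) ≤ (1 + s) * vecNorm x := fun x => by
    have h1 : A *ᵥ (G *ᵥ x) = U *ᵥ x - D *ᵥ x := by
      rw [Matrix.mulVec_mulVec, ← Matrix.sub_mulVec, hUD, add_sub_cancel_right]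
    have h2 := vecNorm_sub_le (U *ᵥ x) (D *ᵥ x)
    rw [← h1, hUx] at h2
    linarith [hDx x]
  have hGdet : IsUnit G.det := by
    rw [isUnit_iff_ne_zero]
    intro h0
    obtain ⟨v, hv0, hv⟩ := Matrix.exists_mulVec_eq_zero_iff.2 h0
    have h1 := hAGl v
    rw [hv, Matrix.mulVec_zero, vecNorm_zero] at h1
    nlinarith [vecNorm_pos hv0]
  have hGi : G * G⁻¹ = 1 := Matrix.mul_nonsing_inv G hGdet
  have hGn : ‖G‖ ≤ (1 + s) / c := opNorm_le_of_mulVec _ (by positivity) fun x => by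
    rw [div_mul_eq_mul_div, le_div_iff₀ hc, mul_comm]
    exact (hA _).trans (hAGu x)
  have hGin : ‖G⁻¹‖ ≤ ‖A‖ / (1 - s) :=
    opNorm_le_of_mulVec _ (div_nonneg (norm_nonneg _) (by linarith)) fun x => by
      have h1 := hAGl (G⁻¹ *ᵥ x)
      rw [Matrix.mulVec_mulVec _ G, hGi, Matrix.one_mulVec] at h1
      rw [div_mul_eq_mul_div, le_div_iff₀ (by linarith), mul_comm]
      exact h1.trans (vecNorm_mulVec_le A x)
  have hU1 : dropLastRow U = dropLastRow A * G + dropLastRow D := by rw [hUD]; rfl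
  have hU2 : dropFirstRow U = dropLastRow A * nodeMatrix f * G + dropFirstRow D := by
    rw [hAdef, ← dropFirstRow_steeringMatrix, ← hAdef]
    conv_lhs => rw [hUD]
    rfl
  have hD1 : ‖dropLastRow D‖ ≤ s := (norm_dropLastRow_le D).trans hG
  have hD2 : ‖dropFirstRow D‖ ≤ s := (norm_dropFirstRow_le D).trans hG
  -- `U₁ = A₁ G + D₁` is bounded below by `(1 - s) / b - s`, which is at least `1 / (2b)` because
  -- `s` and `b s` are at most `1 / 32`.
  obtain ⟨hX1, hXn⟩ := hX.norm_le_inv (τ := (2 * b)⁻¹) (by positivity) fun x => by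
    have h1 : dropLastRow A *ᵥ (G *ᵥ x) = dropLastRow U *ᵥ x - dropLastRow D *ᵥ x := by
      rw [Matrix.mulVec_mulVec, ← Matrix.sub_mulVec, hU1, add_sub_cancel_right]
    have h2 := vecNorm_sub_le (dropLastRow U *ᵥ x) (dropLastRow D *ᵥ x)
    rw [← h1] at h2
    have h3 := (vecNorm_mulVec_le (dropLastRow D) x).trans
      (mul_le_mul_of_nonneg_right hD1 (vecNorm_nonneg x))
    have h4 := (hAGl x).trans (vecNorm_steeringMatrix_mulVec_le hn (G *ᵥ x))
    rw [← hAdef, ← hb] at h4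
    have h5 : (1 - s) * vecNorm x ≤ b * (vecNorm (dropLastRow U *ᵥ x) + s * vecNorm x) :=
      h4.trans (mul_le_mul_of_nonneg_left (by linarith) hb0.le)
    rw [inv_mul_le_iff₀ (by positivity)]
    nlinarith [vecNorm_nonneg x]
  rw [inv_inv] at hXn
  -- From `X U₁ = 1` and `A₁ = (U₁ - D₁) G⁻¹` one gets `X A₁ = G⁻¹ - X D₁ G⁻¹`. Inserting this in `X
  -- U₂ = X (A₁ Z G + D₂)` and conjugating by `G` leaves `Z` plus terms linear in `D₁` and `D₂`.
  have hEq : G * (X * dropFirstRow U) * G⁻¹ - nodeMatrix f =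
      G * (X * (dropFirstRow D * G⁻¹ - dropLastRow D * (G⁻¹ * nodeMatrix f))) := by
    have h1 : X * (dropLastRow A * nodeMatrix f) =
        G⁻¹ * nodeMatrix f - X * (dropLastRow D * (G⁻¹ * nodeMatrix f)) := by
      have h2 : dropLastRow A = (dropLastRow U - dropLastRow D) * G⁻¹ := by
        rw [hU1, add_sub_cancel_right, Matrix.mul_assoc, hGi, Matrix.mul_one]
      rw [h2, Matrix.mul_assoc, Matrix.sub_mul, Matrix.mul_sub, ← Matrix.mul_assoc X, hX1,
        Matrix.one_mul]
    rw [hU2, Matrix.mul_add, Matrix.mul_add, Matrix.add_mul, ← Matrix.mul_assoc X, h1,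
      Matrix.mul_assoc G, Matrix.mul_assoc _ G, hGi, Matrix.mul_one, Matrix.mul_sub,
      ← Matrix.mul_assoc G, hGi, Matrix.one_mul, Matrix.mul_sub, Matrix.mul_sub]
    simp only [Matrix.mul_assoc]
    abel
  refine ⟨G * (X * dropFirstRow U) * G⁻¹ - nodeMatrix f, ?_, ?_⟩
  · rw [add_sub_cancel]
    have := Matrix.charpoly_units_conj (Matrix.nonsingInvUnit G hGdet) (X * dropFirstRow U)
    rw [← this]
    rfl
  · rw [hEq]
    have h1 : ‖dropFirstRow D * G⁻¹ - dropLastRow D * (G⁻¹ * nodeMatrix f)‖ ≤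
        2 * s * (‖A‖ / (1 - s)) := by
      refine (norm_sub_le _ _).trans ?_
      have h2 : ‖dropFirstRow D * G⁻¹‖ ≤ s * (‖A‖ / (1 - s)) :=
        (Matrix.l2_opNorm_mul _ _).trans (mul_le_mul hD2 hGin (norm_nonneg _) hs0)
      have h3 : ‖G⁻¹ * nodeMatrix f‖ ≤ ‖A‖ / (1 - s) := by
        refine (Matrix.l2_opNorm_mul _ _).trans ?_
        refine (mul_le_of_le_one_right (norm_nonneg _) (norm_nodeMatrix_le f)).trans hGin
      have h4 : ‖dropLastRow D * (G⁻¹ * nodeMatrix f)‖ ≤ s * (‖A‖ / (1 - s)) :=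
        (Matrix.l2_opNorm_mul _ _).trans (mul_le_mul hD1 h3 (norm_nonneg _) hs0)
      linarith
    have h2 : ‖X * (dropFirstRow D * G⁻¹ - dropLastRow D * (G⁻¹ * nodeMatrix f))‖ ≤
        2 * b * (2 * s * (‖A‖ / (1 - s))) :=
      (Matrix.l2_opNorm_mul _ _).trans (mul_le_mul hXn h1 (norm_nonneg _) (by positivity))
    refine (Matrix.l2_opNorm_mul _ _).trans
      ((mul_le_mul hGn h2 (norm_nonneg _) (by positivity)).trans ?_)
    have h5 : (1 + s) / (1 - s) ≤ 2 := by
      rw [div_le_iff₀ (by linarith)]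
      linarith
    calc (1 + s) / c * (2 * b * (2 * s * (‖A‖ / (1 - s))))
        = (1 + s) / (1 - s) * (4 * b * s * ‖A‖ / c) := by ring
      _ ≤ 2 * (4 * b * s * ‖A‖ / c) := mul_le_mul_of_nonneg_right h5 (by positivity)
      _ = _ := by ring

/-- The deterministic error bound for ESPRIT. -/
theorem IsEspritEstimate.matchedDist_le (hK : 1 ≤ K) {n : ℕ} (hn : K + 1 ≤ n) {hKn : K ≤ n}
    {f : Fin K → ℝ} (hf : ∀ k, f k ∈ Set.Ico (0 : ℝ) 1) (hf_inj : Function.Injective f)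
    {B : Matrix (Fin K) (Fin K) ℂ} (hB : B.PosDef) {R D : Matrix (Fin n) (Fin n) ℂ} {t δ : ℝ}
    (hR : R = steeringMatrix n f * B * (steeringMatrix n f)ᴴ + (t : ℂ) • 1 + D) (hD : ‖D‖ ≤ δ)
    {g : Fin K → ℝ} (hg : IsEspritEstimate hKn R g) :
    matchedDist g f ≤ min 1 (2 ^ (2 * K + 4) * (K : ℝ) ^ (3 / 2 : ℝ) * √(n : ℝ) *
      (δ / (singularValue K (steeringMatrix n f) ^ 3 * eigenvalue K B))) := by
  set A := steeringMatrix n f with hA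
  have hAinj : ∀ y, A *ᵥ y = 0 → y = 0 := fun y hy =>
    steeringMatrix_mulVec_injective hf hf_inj hKn hy
  set c := singularValue K A with hc
  set l := eigenvalue K B with hl
  have hc0 : 0 < c := singularValue_pos hK A hAinj
  have hl0 : 0 < l := eigenvalue_pos hK hB
  have hδ0 : 0 ≤ δ := (norm_nonneg _).trans hD
  have hhalf := matchedDist_le_half hK g f
  refine le_min (by linarith) ?_
  set b : ℝ := 2 ^ K with hb
  have hb2 : 2 ≤ b := by
    calc (2 : ℝ) = 2 ^ 1 := (pow_one 2).symm
      _ ≤ 2 ^ K := pow_le_pow_right₀ one_le_two hK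
  have hK1 : (1 : ℝ) ≤ K := by exact_mod_cast hK
  have hpow : (K : ℝ) ^ (3 / 2 : ℝ) = K * √(K : ℝ) := by
    rw [show (3 / 2 : ℝ) = 1 + 1 / 2 by norm_num, Real.rpow_add (by linarith), Real.rpow_one,
      Real.sqrt_eq_rpow]
  set γ := c ^ 2 * l with hγ
  have hγ0 : 0 < γ := by positivity
  set r := √(n : ℝ) * √(K : ℝ) with hr
  set x := δ / γ with hx
  have hx0 : 0 ≤ x := by positivity
  have hQ : 2 ^ (2 * K + 4) * (K : ℝ) ^ (3 / 2 : ℝ) * √(n : ℝ) * (δ / (c ^ 3 * l)) =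
      16 * b ^ 2 * K * (r / c) * x := by
    rw [hpow, pow_add, pow_mul', hb, hr, hx, hγ]
    field_simp
    ring
  rw [hQ]
  -- The matched distance never exceeds `1 / 2`, so only a claimed bound below `1 / 2` needs proof.
  by_cases hlarge : 1 / 2 ≤ 16 * b ^ 2 * K * (r / c) * x
  · exact hhalf.trans hlarge
  push Not at hlarge
  have hAn : ‖A‖ ≤ r := norm_steeringMatrix_le n
  -- Since `σ_K(A) ≤ ‖A‖ ≤ √(n K)`, the factor `K (r / c)` is at least `1`; dropping it from the
  -- claimed bound shows that `b² x` is small, hence also `b x` and `x`.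
  have hcr : 1 ≤ r / c := by
    rw [le_div_iff₀ hc0, one_mul]
    have h1 : (fun _ => 1 : Fin K → ℂ) ≠ 0 := fun h => by
      simpa using congrFun h ⟨0, hK⟩
    exact (le_of_mul_le_mul_right ((singularValue_mul_vecNorm_le hK A _).trans
      (vecNorm_mulVec_le A _)) (vecNorm_pos h1)).trans hAn
  have hxs : 16 * b ^ 2 * x < 1 / 2 := by
    refine lt_of_le_of_lt ?_ hlarge
    have h1 : 1 ≤ K * (r / c) := one_le_mul_of_one_le_of_one_le hK1 hcr
    calc 16 * b ^ 2 * x ≤ 16 * b ^ 2 * x * (K * (r / c)) := le_mul_of_one_le_right (by positivity) h1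
      _ = _ := by ring
  have hxb : b * x ≤ 1 / 64 := by nlinarith
  have hxδ : δ = x * γ := by rw [hx]; field_simp
  have hx1 : x ≤ 1 / 128 := by nlinarith
  have hδγ : δ < γ := by rw [hxδ]; nlinarith
  have hs : δ / (γ - δ) ≤ 2 * x := by
    rw [div_le_iff₀ (sub_pos.2 hδγ), hxδ]
    nlinarith [mul_nonneg hx0 hγ0.le]
  obtain ⟨U, X, z, hU, hX, hz, hzg⟩ := hg
  obtain ⟨G, hG⟩ := hU.exists_approx hK hR hD hAinj
    (gap_mul_le hK A hB.1 hl0.le hc0) hδγ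
  obtain ⟨F, hF, hFn⟩ := exists_similar_perturbation hn f hU.isometry hX (hG.trans hs)
    (by rw [← hb]; linarith) (by linarith) hc0 (singularValue_mul_vecNorm_le hK A)
  rw [hz] at hF
  obtain ⟨ψ, hψ⟩ := exists_perm_norm_sub_le hF.symm
  refine Esprit.matchedDist_le hK ψ fun k => ?_
  refine (wrapDist_le_half_norm (hzg (ψ k)).1 (hf k) (hzg (ψ k)).2).trans ?_
  calc ‖z (ψ k) - node (f k)‖ / 2 ≤ K * ‖F‖ := by linarith [hψ k]
    _ ≤ K * (8 * b * (2 * x) * r / c) := by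
        refine mul_le_mul_of_nonneg_left (hFn.trans ?_) (by positivity)
        gcongr
    _ = 16 * b * K * (r / c) * x := by ring
    -- The spare factor `b` is given away here; it served only to make `b x` small above.
    _ ≤ 16 * b ^ 2 * K * (r / c) * x := by
        gcongr
        nlinarith

end Estimate

/-! ### Nets on the unit sphere -/

/-- Volume comparison: the balls of radius `1/8` about the points are disjoint and lie in the ball
of radius `9/8`. -/
lemma card_le_of_quarter_separated {E : Type*} [NormedAddCommGroup E] [NormedSpace ℝ E]
    [FiniteDimensional ℝ E] (s : Finset E) (hs : ∀ c ∈ s, ‖c‖ ≤ 1)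
    (h : ∀ c ∈ s, ∀ d ∈ s, c ≠ d → 1 / 4 ≤ ‖c - d‖) : s.card ≤ 9 ^ Module.finrank ℝ E := by
  borelize E
  let ν : Measure E := Measure.addHaar
  have hdisj : Set.Pairwise (s : Set E)
      (Function.onFun Disjoint fun c => Metric.ball (c : E) (1 / 8)) := by
    rintro c hc d hd hcd
    apply Metric.ball_disjoint_ball
    rw [dist_eq_norm]
    linarith [h c hc d hd hcd]
  have hsub : (⋃ c ∈ s, Metric.ball (c : E) (1 / 8)) ⊆ Metric.ball (0 : E) (9 / 8) := by
    refine Set.iUnion₂_subset fun x hx => Metric.ball_subset_ball' ?_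
    rw [dist_zero_right]
    linarith [hs x hx]
  have h1 : (s.card : ENNReal) * ENNReal.ofReal ((1 / 8) ^ Module.finrank ℝ E) *
      ν (Metric.ball 0 1) ≤ ENNReal.ofReal ((9 / 8) ^ Module.finrank ℝ E) * ν (Metric.ball 0 1) :=
    calc _ = ν (⋃ c ∈ s, Metric.ball (c : E) (1 / 8)) := by
          rw [measure_biUnion_finset hdisj fun c _ => measurableSet_ball]
          simp only [ν.addHaar_ball_of_pos _ (show (0 : ℝ) < 1 / 8 by norm_num), Finset.sum_const,
            nsmul_eq_mul, mul_assoc]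
      _ ≤ ν (Metric.ball (0 : E) (9 / 8)) := measure_mono hsub
      _ = _ := by rw [ν.addHaar_ball_of_pos _ (show (0 : ℝ) < 9 / 8 by norm_num)]
  have h2 := (ENNReal.mul_le_mul_iff_left (Metric.measure_ball_pos _ _ zero_lt_one).ne'
    measure_ball_lt_top.ne).1 h1
  have h3 := ENNReal.toReal_le_of_le_ofReal (by positivity) h2
  rw [ENNReal.toReal_mul, ENNReal.toReal_natCast, ENNReal.toReal_ofReal (by positivity),
    div_pow, div_pow, one_pow, mul_one_div, div_le_div_iff_of_pos_right (by positivity)] at h3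
  exact_mod_cast h3

/-- A separated set of maximal cardinality is a net. The real dimension is `2n`, whence `9 ^ (2n) =
81 ^ n`. -/
lemma exists_sphere_net (n : ℕ) : ∃ s : Finset (Fin n → ℂ), s.card ≤ 81 ^ n ∧
    (∀ y ∈ s, vecNorm y = 1) ∧
    ∀ x : Fin n → ℂ, vecNorm x = 1 → ∃ y ∈ s, vecNorm (x - y) ≤ 1 / 4 := by
  classical
  set p : Finset (Fin n → ℂ) → Prop := fun s => (∀ y ∈ s, vecNorm y = 1) ∧
    ∀ c ∈ s, ∀ d ∈ s, c ≠ d → 1 / 4 ≤ vecNorm (c - d) with hp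
  have hcard : ∀ s, p s → s.card ≤ 81 ^ n := by
    intro s hs
    have h := card_le_of_quarter_separated
      (s.map (WithLp.equiv 2 (Fin n → ℂ)).symm.toEmbedding : Finset (EuclideanSpace ℂ (Fin n)))
      (by
        intro c hc
        obtain ⟨y, hy, rfl⟩ := Finset.mem_map.1 hc
        exact (hs.1 y hy).le)
      (by
        intro c hc d hd hcd
        obtain ⟨y, hy, rfl⟩ := Finset.mem_map.1 hc
        obtain ⟨z, hz, rfl⟩ := Finset.mem_map.1 hd
        exact hs.2 y hy z hz fun h => hcd (by rw [h]))
    rw [Finset.card_map, ← Module.finrank_mul_finrank ℝ ℂ, Complex.finrank_real_complex,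
      finrank_euclideanSpace_fin, pow_mul] at h
    norm_num at h
    exact h
  obtain ⟨s, hs, hmax⟩ : ∃ s, p s ∧ ∀ s', p s' → s'.card ≤ s.card := by
    set T : Set ℕ := Finset.card '' {s | p s} with hT
    have hb : BddAbove T := ⟨81 ^ n, by rintro _ ⟨s, hs, rfl⟩; exact hcard s hs⟩
    obtain ⟨s, hs, hsT⟩ := Nat.sSup_mem (s := T) ⟨0, ∅, by simp [hp], rfl⟩ hb
    exact ⟨s, hs, fun s' hs' => by rw [hsT]; exact le_csSup hb ⟨s', hs', rfl⟩⟩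
  refine ⟨s, hcard s hs, hs.1, fun x hx => ?_⟩
  by_contra! hfar
  have hxs : x ∉ s := fun h => by
    have := hfar x h
    rw [sub_self, vecNorm_zero] at this
    norm_num at this
  have hsymm : ∀ a b : Fin n → ℂ, vecNorm (a - b) = vecNorm (b - a) := fun a b =>
    norm_sub_rev (WithLp.toLp 2 a : EuclideanSpace ℂ (Fin n)) (WithLp.toLp 2 b)
  have h := hmax (insert x s) ⟨?_, ?_⟩
  · rw [Finset.card_insert_of_notMem hxs] at h
    omega
  · intro y hy
    rcases Finset.mem_insert.1 hy with rfl | hy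
    exacts [hx, hs.1 y hy]
  · intro c hc d hd hcd
    rcases Finset.mem_insert.1 hc with hc | hc <;> rcases Finset.mem_insert.1 hd with hd | hd
    · exact absurd (hc.trans hd.symm) hcd
    · rw [hc]; exact (hfar d hd).le
    · rw [hd, hsymm]; exact (hfar c hc).le
    · exact hs.2 c hc d hd hcd

section Net

variable {m n : ℕ}

lemma opNorm_le_of_unit (A : Matrix (Fin m) (Fin n) ℂ) {c : ℝ} (hc : 0 ≤ c)
    (h : ∀ x, vecNorm x = 1 → vecNorm (A *ᵥ x) ≤ c) : ‖A‖ ≤ c := by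
  refine opNorm_le_of_mulVec A hc fun v => ?_
  by_cases hv : v = 0
  · rw [hv, Matrix.mulVec_zero, vecNorm_zero, vecNorm_zero, mul_zero]
  have hv0 := vecNorm_pos hv
  have hn : ‖((vecNorm v)⁻¹ : ℂ)‖ = (vecNorm v)⁻¹ := by
    rw [norm_inv, Complex.norm_real, Real.norm_eq_abs, abs_of_pos hv0]
  have h1 := h (((vecNorm v)⁻¹ : ℂ) • v) (by rw [vecNorm_smul, hn, inv_mul_cancel₀ hv0.ne'])
  rwa [Matrix.mulVec_smul, vecNorm_smul, hn, inv_mul_le_iff₀ hv0, mul_comm] at h1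

lemma opNorm_le_of_net {s : Finset (Fin n → ℂ)}
    (hs : ∀ x : Fin n → ℂ, vecNorm x = 1 → ∃ y ∈ s, vecNorm (x - y) ≤ 1 / 4)
    (A : Matrix (Fin m) (Fin n) ℂ) {c : ℝ} (hc : 0 ≤ c) (h : ∀ y ∈ s, vecNorm (A *ᵥ y) ≤ 3 * c) :
    ‖A‖ ≤ 4 * c := by
  have h1 : ‖A‖ ≤ 3 * c + ‖A‖ * (1 / 4) := opNorm_le_of_unit A (by positivity) fun x hx => by
    obtain ⟨y, hy, hxy⟩ := hs x hx
    have h2 := vecNorm_add_le (A *ᵥ y) (A *ᵥ (x - y))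
    rw [← Matrix.mulVec_add, add_sub_cancel] at h2
    have h3 := (vecNorm_mulVec_le A (x - y)).trans (mul_le_mul_of_nonneg_left hxy (norm_nonneg A))
    linarith [h y hy]
  linarith

/-- Polarisation at `y` and `W y`, rescaled to a common norm so that the parallelogram law loses
nothing. -/
lemma opNorm_le_of_quadForm {W : Matrix (Fin n) (Fin n) ℂ} (hW : W.IsHermitian) {q : ℝ}
    (hq : 0 ≤ q) (h : ∀ x, |(star x ⬝ᵥ (W *ᵥ x)).re| ≤ q * vecNorm x ^ 2) : ‖W‖ ≤ q := by
  refine opNorm_le_of_mulVec W hq fun y => ?_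
  set a := vecNorm y with ha
  set b := vecNorm (W *ᵥ y) with hb
  rcases (vecNorm_nonneg (W *ᵥ y)).eq_or_lt with h0 | hb0
  · rw [hb, ← h0]; exact mul_nonneg hq (vecNorm_nonneg y)
  have ha0 : 0 < a := vecNorm_pos fun hy => by rw [hy, Matrix.mulVec_zero, vecNorm_zero] at hb0; exact hb0.false
  set u : Fin n → ℂ := (b : ℂ) • y with hu
  set v : Fin n → ℂ := (a : ℂ) • (W *ᵥ y) with hv
  have hWu : W *ᵥ u = (b : ℂ) • (W *ᵥ y) := Matrix.mulVec_smul _ _ _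
  have hvu : star v ⬝ᵥ (W *ᵥ u) = ((a * b * b ^ 2 : ℝ) : ℂ) := by
    rw [hWu, hv, star_smul, smul_dotProduct, dotProduct_smul, star_dotProduct_self, ← hb]
    simp
    ring
  have huv : star u ⬝ᵥ (W *ᵥ v) = ((a * b * b ^ 2 : ℝ) : ℂ) := by
    have h1 : star u ⬝ᵥ (W *ᵥ v) = star (W *ᵥ u) ⬝ᵥ v := by
      rw [mulVec_star_dotProduct, hW.eq]
    rw [h1, hWu, hv, star_smul, smul_dotProduct, dotProduct_smul, star_dotProduct_self, ← hb]
    simp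
    ring
  have hnu : vecNorm u = a * b := by
    rw [hu, vecNorm_smul, Complex.norm_real, Real.norm_eq_abs, abs_of_pos hb0, mul_comm]
  have hnv : vecNorm v = a * b := by
    rw [hv, vecNorm_smul, Complex.norm_real, Real.norm_eq_abs, abs_of_pos ha0]
  have h1 := (le_abs_self _).trans (h (u + v))
  have h2 := (neg_le_abs _).trans (h (u - v))
  have hexp1 : star (u + v) ⬝ᵥ (W *ᵥ (u + v)) = star u ⬝ᵥ (W *ᵥ u) + star v ⬝ᵥ (W *ᵥ v) +
      2 * ((a * b * b ^ 2 : ℝ) : ℂ) := by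
    rw [star_add, Matrix.mulVec_add, add_dotProduct, dotProduct_add, dotProduct_add, huv, hvu]
    ring
  have hexp2 : star (u - v) ⬝ᵥ (W *ᵥ (u - v)) = star u ⬝ᵥ (W *ᵥ u) + star v ⬝ᵥ (W *ᵥ v) -
      2 * ((a * b * b ^ 2 : ℝ) : ℂ) := by
    rw [star_sub, Matrix.mulVec_sub, sub_dotProduct, dotProduct_sub, dotProduct_sub, huv, hvu]
    ring
  have hpar : vecNorm (u + v) ^ 2 + vecNorm (u - v) ^ 2 = 4 * (a * b) ^ 2 := by
    have := parallelogram_law_with_norm ℂ (WithLp.toLp 2 u : EuclideanSpace ℂ (Fin n))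
      (WithLp.toLp 2 v)
    change vecNorm (u + v) ^ 2 + vecNorm (u - v) ^ 2 = 2 * (vecNorm u ^ 2 + vecNorm v ^ 2) at this
    rw [hnu, hnv] at this
    linarith
  have hre : ((2 * ((a * b * b ^ 2 : ℝ) : ℂ) : ℂ)).re = 2 * (a * b * b ^ 2) := by
    rw [show (2 * ((a * b * b ^ 2 : ℝ) : ℂ) : ℂ) = ((2 * (a * b * b ^ 2) : ℝ) : ℂ) by push_cast; ring,
      Complex.ofReal_re]
  rw [hexp1, Complex.add_re, hre] at h1
  rw [hexp2, Complex.sub_re, hre] at h2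
  have h3 : 4 * (a * b * b ^ 2) ≤ q * (4 * (a * b) ^ 2) := by
    rw [← hpar]
    linarith
  have hab : 0 < a * b ^ 2 := by positivity
  refine le_of_mul_le_mul_right ?_ hab
  nlinarith

/-- Replacing `x` by a net point changes the quadratic form by at most `2 · ‖W‖ / 4`, so `‖W‖ ≤ c +
‖W‖ / 2`. -/
lemma opNorm_le_of_net_quadForm {s : Finset (Fin n → ℂ)} (hs1 : ∀ y ∈ s, vecNorm y = 1)
    (hs : ∀ x : Fin n → ℂ, vecNorm x = 1 → ∃ y ∈ s, vecNorm (x - y) ≤ 1 / 4)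
    {W : Matrix (Fin n) (Fin n) ℂ} (hW : W.IsHermitian) {c : ℝ} (hc : 0 ≤ c)
    (h : ∀ y ∈ s, |(star y ⬝ᵥ (W *ᵥ y)).re| ≤ c) : ‖W‖ ≤ 2 * c := by
  have h0 : ∀ x, vecNorm x = 1 → |(star x ⬝ᵥ (W *ᵥ x)).re| ≤ c + ‖W‖ * (1 / 2) := by
    intro x hx
    obtain ⟨y, hy, hxy⟩ := hs x hx
    have h1 : star x ⬝ᵥ (W *ᵥ x) = star y ⬝ᵥ (W *ᵥ y) + star (x - y) ⬝ᵥ (W *ᵥ x) +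
        star y ⬝ᵥ (W *ᵥ (x - y)) := by
      rw [star_sub, Matrix.mulVec_sub, sub_dotProduct, dotProduct_sub]
      ring
    have h2 : ‖star (x - y) ⬝ᵥ (W *ᵥ x)‖ ≤ 1 / 4 * ‖W‖ := by
      refine (norm_star_dotProduct_le _ _).trans
        (mul_le_mul hxy ?_ (vecNorm_nonneg _) (by norm_num))
      simpa [hx] using vecNorm_mulVec_le W x
    have h3 : ‖star y ⬝ᵥ (W *ᵥ (x - y))‖ ≤ ‖W‖ * (1 / 4) := by
      refine (norm_star_dotProduct_le _ _).trans ?_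
      rw [hs1 y hy, one_mul]
      exact (vecNorm_mulVec_le W _).trans (mul_le_mul_of_nonneg_left hxy (norm_nonneg W))
    rw [h1, Complex.add_re, Complex.add_re]
    have h4 := (Complex.abs_re_le_norm _).trans h2
    have h5 := (Complex.abs_re_le_norm _).trans h3
    have h6 := abs_add_three (star y ⬝ᵥ (W *ᵥ y)).re (star (x - y) ⬝ᵥ (W *ᵥ x)).re
      (star y ⬝ᵥ (W *ᵥ (x - y))).re
    linarith [h y hy]
  have h1 : ‖W‖ ≤ c + ‖W‖ * (1 / 2) := by
    refine opNorm_le_of_quadForm hW (by positivity) fun x => ?_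
    by_cases hx : x = 0
    · simp [hx, vecNorm_zero]
    have hx0 := vecNorm_pos hx
    set t := (vecNorm x)⁻¹ with ht
    have ht0 : 0 < t := inv_pos.2 hx0
    have h2 := h0 ((t : ℂ) • x) (by
      rw [vecNorm_smul, Complex.norm_real, Real.norm_eq_abs, abs_of_pos ht0, ht,
        inv_mul_cancel₀ hx0.ne'])
    have h3 : star ((t : ℂ) • x) ⬝ᵥ (W *ᵥ ((t : ℂ) • x)) =
        ((t ^ 2 : ℝ) : ℂ) * (star x ⬝ᵥ (W *ᵥ x)) := by
      rw [star_smul, Matrix.mulVec_smul, smul_dotProduct, dotProduct_smul]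
      simp
      ring
    rw [h3, Complex.re_ofReal_mul, abs_mul, abs_of_pos (by positivity), ht, inv_pow,
      inv_mul_le_iff₀ (by positivity), mul_comm] at h2
    exact h2
  linarith

end Net

/-! ### Complex Gaussian variables -/

lemma measurable_re_add_im : Measurable fun x : ℝ × ℝ => (x.1 : ℂ) + (x.2 : ℂ) * Complex.I := by
  fun_prop

instance isProbabilityMeasure_complexGaussian (σ : ℝ) :
    IsProbabilityMeasure (complexGaussian σ) :=
  Measure.isProbabilityMeasure_map measurable_re_add_im.aemeasurable

lemma charFun_complexGaussian (σ : ℝ) (t : ℂ) :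
    charFun (complexGaussian σ) t = Complex.exp ((-(σ ^ 2 * ‖t‖ ^ 2 / 4) : ℝ) : ℂ) := by
  rw [charFun_apply, complexGaussian, integral_map measurable_re_add_im.aemeasurable
    (by fun_prop)]
  have h1 : ∀ x : ℝ × ℝ, Complex.exp ((inner ℝ ((x.1 : ℂ) + (x.2 : ℂ) * Complex.I) t : ℝ) * Complex.I) =
      Complex.exp (t.re * x.1 * Complex.I) * Complex.exp (t.im * x.2 * Complex.I) := by
    intro x
    rw [← Complex.exp_add, Complex.inner]
    congr 1
    simp
    ring
  simp_rw [h1]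
  rw [integral_prod_mul (fun a : ℝ => Complex.exp (t.re * a * Complex.I))
    (fun a : ℝ => Complex.exp (t.im * a * Complex.I)), ← charFun_apply_real, ← charFun_apply_real,
    charFun_gaussianReal, charFun_gaussianReal, ← Complex.exp_add,
    Real.coe_toNNReal _ (by positivity), Complex.sq_norm, Complex.normSq_apply]
  congr 1
  push_cast
  ring

lemma integral_exp_mul_sq_gaussianReal {v : NNReal} {t : ℝ} (h : 2 * v * t < 1) :
    ∫ a, Real.exp (t * a ^ 2) ∂gaussianReal 0 v = (√(1 - 2 * v * t))⁻¹ := by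
  by_cases hv : v = 0
  · subst hv
    simp [gaussianReal_zero_var]
  have hv0 : (0 : ℝ) < v := by exact_mod_cast pos_iff_ne_zero.2 hv
  rw [integral_gaussianReal_eq_integral_smul hv]
  have h1 : ∀ a : ℝ, gaussianPDFReal 0 v a • Real.exp (t * a ^ 2) =
      (√(2 * Real.pi * v))⁻¹ * Real.exp (-((1 - 2 * v * t) / (2 * v)) * a ^ 2) := by
    intro a
    rw [gaussianPDFReal, smul_eq_mul, mul_assoc, ← Real.exp_add]
    congr 2
    field_simp
    ring
  simp_rw [h1]
  rw [integral_const_mul, integral_gaussian, ← Real.sqrt_inv, ← Real.sqrt_inv,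
    ← Real.sqrt_mul (by positivity)]
  congr 1
  have := Real.pi_pos
  have h2 : 0 < 1 - 2 * v * t := by linarith
  field_simp

lemma integral_exp_mul_norm_sq_complexGaussian {s t : ℝ} (h : s ^ 2 * t < 1) :
    ∫ w, Real.exp (t * ‖w‖ ^ 2) ∂complexGaussian s = (1 - s ^ 2 * t)⁻¹ := by
  rw [complexGaussian, integral_map measurable_re_add_im.aemeasurable (by fun_prop)]
  have h1 : ∀ x : ℝ × ℝ, Real.exp (t * ‖(x.1 : ℂ) + (x.2 : ℂ) * Complex.I‖ ^ 2) =
      Real.exp (t * x.1 ^ 2) * Real.exp (t * x.2 ^ 2) := by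
    intro x
    rw [← Real.exp_add, Complex.sq_norm, Complex.normSq_add_mul_I]
    ring_nf
  simp_rw [h1]
  have h2 : 2 * ((s ^ 2 / 2).toNNReal : ℝ) * t = s ^ 2 * t := by
    rw [Real.coe_toNNReal _ (by positivity)]
    ring
  rw [integral_prod_mul (fun a : ℝ => Real.exp (t * a ^ 2)) (fun a : ℝ => Real.exp (t * a ^ 2)),
    integral_exp_mul_sq_gaussianReal (by rw [h2]; exact h), h2, ← mul_inv,
    Real.mul_self_sqrt (by linarith)]

lemma complexGaussian_zero : complexGaussian 0 = Measure.dirac 0 := by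
  have : ((0 : ℝ) ^ 2 / 2).toNNReal = 0 := by simp
  rw [complexGaussian, this, gaussianReal_zero_var, Measure.dirac_prod_dirac,
    Measure.map_dirac' measurable_re_add_im]
  simp

section Sums

variable {Ω : Type*} [MeasurableSpace Ω] {μ : Measure Ω}

/-- Characteristic functions multiply, and by circular symmetry each factor depends only on `‖c i‖
‖t‖`. -/
lemma hasLaw_sum_complexGaussian [IsProbabilityMeasure μ] {ι : Type*} [Fintype ι] {X : ι → Ω → ℂ} (hX : iIndepFun X μ)
    (hXm : ∀ i, Measurable (X i)) {σ : ℝ} (hlaw : ∀ i, HasLaw (X i) (complexGaussian σ) μ)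
    (c : ι → ℂ) :
    HasLaw (fun ω => ∑ i, X i ω * c i) (complexGaussian (σ * vecNorm c)) μ := by
  have hm : Measurable fun ω => ∑ i, X i ω * c i := by fun_prop
  refine ⟨hm.aemeasurable, ?_⟩
  have := Measure.isProbabilityMeasure_map (μ := μ) hm.aemeasurable
  refine Measure.ext_of_charFun ?_
  have hind : iIndepFun (fun i ω => X i ω * c i) μ :=
    hX.comp (fun i x => x * c i) fun i => by fun_prop
  have h := hind.charFun_map_fun_sum_eq_prod (fun i => by fun_prop)
  ext t
  rw [h, Finset.prod_apply, charFun_complexGaussian]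
  have h1 : ∀ i, charFun (μ.map fun ω => X i ω * c i) t =
      Complex.exp ((-(σ ^ 2 * ‖t‖ ^ 2 / 4) * ‖c i‖ ^ 2 : ℝ) : ℂ) := by
    intro i
    have h2 : charFun (μ.map fun ω => X i ω * c i) t =
        charFun (complexGaussian σ) (starRingEnd ℂ (c i) * t) := by
      rw [← (hlaw i).map_eq, charFun_apply, charFun_apply, integral_map (by fun_prop) (by fun_prop),
        integral_map (by fun_prop) (by fun_prop)]
      refine integral_congr_ae (ae_of_all _ fun ω => ?_)
      simp only [Complex.inner, map_mul]
      congr 4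
      ring
    rw [h2, charFun_complexGaussian, norm_mul, Complex.norm_conj]
    congr 2
    ring
  simp_rw [h1]
  rw [← Complex.exp_sum, ← Complex.ofReal_sum, ← Finset.mul_sum, ← vecNorm_sq]
  congr 2
  ring

/-- Families of variables which depend on disjoint blocks of an independent family are
independent. -/
lemma iIndepFun_blocks [IsProbabilityMeasure μ] {ι κ : Type*} [Fintype ι] [Fintype κ] {X : ι → κ → Ω → ℂ}
    (hX : iIndepFun (fun (p : (_ : ι) × κ) ω => X p.1 p.2 ω) μ) (hXm : ∀ i j, Measurable (X i j)) :
    iIndepFun (fun i ω => (X i · ω)) μ := by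
  have h1 : ∀ i j, IsProbabilityMeasure (μ.map (X i j)) :=
    fun i j => Measure.isProbabilityMeasure_map (hXm i j).aemeasurable
  have h2 : ∀ i, IsProbabilityMeasure (μ.map (fun ω => (X i · ω))) :=
    fun i => Measure.isProbabilityMeasure_map (Measurable.aemeasurable (by fun_prop))
  rw [iIndepFun_iff_map_fun_eq_infinitePi_map (by fun_prop)] at hX ⊢
  have h3 : (MeasurableEquiv.piCurry fun (_ : ι) (_ : κ) => ℂ) ∘ (fun ω p => X p.1 p.2 ω) =
      fun ω i j => X i j ω := by
    ext
    simp [Sigma.curry]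
  have h4 := congrArg (Measure.map (MeasurableEquiv.piCurry fun (_ : ι) (_ : κ) => ℂ)) hX
  rw [Measure.map_map (by fun_prop) (by fun_prop), h3,
    Measure.infinitePi_map_piCurry (fun i j => μ.map (X i j))] at h4
  rw [h4]
  congr 1
  ext1 i
  have h5 : iIndepFun (X i) μ := by
    have := (iIndepFun_iff_map_fun_eq_infinitePi_map (by fun_prop)).2 hX
    exact this.precomp (g := fun j => (⟨i, j⟩ : (_ : ι) × κ)) fun a b h => by simpa using h
  exact ((iIndepFun_iff_map_fun_eq_infinitePi_map (hXm i)).1 h5).symm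

lemma integral_exp_mul_sum_norm_sq {n : ℕ} {W : Fin n → Ω → ℂ} (hW : iIndepFun W μ)
    {s t : ℝ} (hlaw : ∀ i, HasLaw (W i) (complexGaussian s) μ) (h : s ^ 2 * t < 1) :
    ∫ ω, Real.exp (t * ∑ i, ‖W i ω‖ ^ 2) ∂μ = ((1 - s ^ 2 * t)⁻¹) ^ n := by
  have h1 := hW.integral_fun_prod_comp (f := fun _ w => Real.exp (t * ‖w‖ ^ 2))
    (fun i => (hlaw i).aemeasurable) (fun i => by fun_prop)
  have h2 : ∀ i, ∫ ω, Real.exp (t * ‖W i ω‖ ^ 2) ∂μ = (1 - s ^ 2 * t)⁻¹ := by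
    intro i
    rw [← integral_exp_mul_norm_sq_complexGaussian h, ← (hlaw i).map_eq,
      integral_map (hlaw i).aemeasurable (by fun_prop)]
  simp_rw [h2] at h1
  rw [Finset.prod_const, Finset.card_univ, Fintype.card_fin] at h1
  rw [← h1]
  refine integral_congr_ae (ae_of_all _ fun ω => ?_)
  simp only
  rw [← Real.exp_sum, Finset.mul_sum]

lemma integrable_exp_mul_sum_norm_sq {n : ℕ} {W : Fin n → Ω → ℂ} (hW : iIndepFun W μ)
    {s t : ℝ} (hlaw : ∀ i, HasLaw (W i) (complexGaussian s) μ) (h : s ^ 2 * t < 1) :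
    Integrable (fun ω => Real.exp (t * ∑ i, ‖W i ω‖ ^ 2)) μ := by
  -- The integral of a non-integrable function is `0` by convention, so the nonzero value just
  -- computed proves integrability.
  refine Integrable.of_integral_ne_zero ?_
  rw [integral_exp_mul_sum_norm_sq hW hlaw h]
  exact pow_ne_zero _ (inv_ne_zero (by linarith))

lemma measure_sum_norm_sq_gt_le [IsProbabilityMeasure μ] {n : ℕ} {W : Fin n → Ω → ℂ} (hW : iIndepFun W μ) {s : ℝ}
    (hlaw : ∀ i, HasLaw (W i) (complexGaussian s) μ) {u : ℝ} (hu : 0 ≤ u) :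
    μ.real {ω | (1 + u) * (n * s ^ 2) < ∑ i, ‖W i ω‖ ^ 2} ≤
      Real.exp (-(n * (u - Real.log (1 + u)))) := by
  by_cases hs : s = 0
  · subst hs
    have h0 : ∀ᵐ ω ∂μ, ∀ i, W i ω = 0 := by
      rw [ae_all_iff]
      intro i
      have h1 : ∀ᵐ w ∂(μ.map (W i)), w = 0 := by
        rw [(hlaw i).map_eq, complexGaussian_zero]
        simp
      exact ae_of_ae_map (hlaw i).aemeasurable h1
    have h1 : μ.real {ω | (1 + u) * (n * (0 : ℝ) ^ 2) < ∑ i, ‖W i ω‖ ^ 2} = 0 := by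
      rw [measureReal_eq_zero_iff]
      refine measure_mono_null (fun ω hω => ?_) (ae_iff.1 h0)
      intro hω0
      simp [hω0] at hω
    rw [h1]
    exact (Real.exp_pos _).le
  have hs2 : 0 < s ^ 2 := by positivity
  have hu1 : 0 < 1 + u := by linarith
  -- The optimal Chernoff exponent, at which `1 - s² t = 1 / (1 + u)`.
  set t := u / (1 + u) / s ^ 2 with ht
  have hst : s ^ 2 * t = u / (1 + u) := by rw [ht]; field_simp
  have hst1 : 1 - s ^ 2 * t = (1 + u)⁻¹ := by rw [hst]; field_simp; ring
  have hlt : s ^ 2 * t < 1 := by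
    rw [hst, div_lt_one hu1]
    linarith
  have h := measure_ge_le_exp_mul_mgf (μ := μ) (X := fun ω => ∑ i, ‖W i ω‖ ^ 2) (t := t)
    ((1 + u) * (n * s ^ 2)) (by positivity) (integrable_exp_mul_sum_norm_sq hW hlaw hlt)
  rw [mgf, integral_exp_mul_sum_norm_sq hW hlaw hlt, hst1, inv_inv] at h
  refine le_trans (measureReal_mono (fun ω hω => ?_) (measure_ne_top μ _)) (h.trans_eq ?_)
  · exact (Set.mem_ofPred_eq.mp hω).le
  rw [← Real.exp_log hu1, ← Real.exp_nat_mul, Real.exp_log hu1, ← Real.exp_add]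
  congr 1
  have : t * ((1 + u) * (n * s ^ 2)) = n * u := by rw [ht]; field_simp
  linarith

lemma measure_sum_norm_sq_lt_le [IsProbabilityMeasure μ] {n : ℕ} {W : Fin n → Ω → ℂ} (hW : iIndepFun W μ) {s : ℝ}
    (hlaw : ∀ i, HasLaw (W i) (complexGaussian s) μ) {u : ℝ} (hu : 0 ≤ u) :
    μ.real {ω | ∑ i, ‖W i ω‖ ^ 2 < (1 - u) * (n * s ^ 2)} ≤ Real.exp (-(n * (u ^ 2 / 2))) := by
  by_cases hc : s = 0 ∨ 1 ≤ u
  · have h1 : {ω | ∑ i, ‖W i ω‖ ^ 2 < (1 - u) * (n * s ^ 2)} = ∅ := by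
      refine Set.eq_empty_of_forall_notMem fun ω hω => ?_
      have h2 : ∑ i, ‖W i ω‖ ^ 2 < (1 - u) * (n * s ^ 2) := hω
      have h3 : 0 ≤ ∑ i, ‖W i ω‖ ^ 2 := Finset.sum_nonneg fun i _ => sq_nonneg _
      rcases hc with rfl | hc
      · simp at h2
        linarith
      · have : (1 - u) * (n * s ^ 2) ≤ 0 :=
          mul_nonpos_of_nonpos_of_nonneg (by linarith) (by positivity)
        linarith
    rw [h1, measureReal_empty]
    exact (Real.exp_pos _).le
  push Not at hc
  obtain ⟨hs, hu1⟩ := hc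
  have hs2 : 0 < s ^ 2 := by positivity
  -- Not the optimal exponent, but the resulting `u - u² - log (1 + u)` is at most `-u² / 2` by `log
  -- (1 + u) ≥ u - u² / 2`.
  set t := -u / s ^ 2 with ht
  have hst : s ^ 2 * t = -u := by rw [ht]; field_simp
  have hlt : s ^ 2 * t < 1 := by linarith
  have h := measure_le_le_exp_mul_mgf (μ := μ) (X := fun ω => ∑ i, ‖W i ω‖ ^ 2) (t := t)
    ((1 - u) * (n * s ^ 2)) (div_nonpos_of_nonpos_of_nonneg (by linarith) hs2.le)
    (integrable_exp_mul_sum_norm_sq hW hlaw hlt)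
  rw [mgf, integral_exp_mul_sum_norm_sq hW hlaw hlt, hst, sub_neg_eq_add] at h
  refine le_trans (measureReal_mono (fun ω hω => ?_) (measure_ne_top μ _)) (h.trans ?_)
  · exact (Set.mem_ofPred_eq.mp hω).le
  have hu1 : 0 < 1 + u := by linarith
  rw [← Real.exp_log (inv_pos.2 hu1), ← Real.exp_nat_mul, ← Real.exp_add, Real.log_inv]
  refine Real.exp_le_exp.2 ?_
  have h1 : -t * ((1 - u) * (n * s ^ 2)) = n * (u * (1 - u)) := by rw [ht]; field_simp
  have h2 : u - u ^ 2 / 2 ≤ Real.log (1 + u) := by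
    refine le_trans ?_ (Real.le_log_one_add_of_nonneg hu)
    rw [le_div_iff₀ (by linarith)]
    nlinarith [pow_nonneg hu 3]
  rw [h1, mul_neg, ← sub_eq_add_neg, ← mul_sub, ← mul_neg]
  refine mul_le_mul_of_nonneg_left ?_ (Nat.cast_nonneg n)
  linarith

end Sums

/-! ### Concentration of the noise -/

/-- A Padé bound: after clearing denominators, the comparison of derivatives reads `0 ≤ 4 x³`. It
yields the rate `u - log (1 + u) ≥ 3u² / (4u + 6)`. -/
lemma log_one_add_le {u : ℝ} (hu : 0 ≤ u) : Real.log (1 + u) ≤ u * (u + 6) / (4 * u + 6) := by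
  have hd : ∀ x : ℝ, 0 ≤ x → HasDerivAt (fun x => x * (x + 6) / (4 * x + 6) - Real.log (1 + x))
      (((1 * (x + 6) + x * 1) * (4 * x + 6) - x * (x + 6) * (4 * 1)) / (4 * x + 6) ^ 2 - 1 / (1 + x))
      x := by
    intro x hx
    refine HasDerivAt.sub ?_ ?_
    · exact ((hasDerivAt_id x).mul ((hasDerivAt_id x).add_const 6)).div
        (((hasDerivAt_id x).const_mul 4).add_const 6) (by change 4 * x + 6 ≠ 0; positivity)
    · exact ((hasDerivAt_id x).const_add 1).log (by change 1 + x ≠ 0; positivity)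
  have hmono : MonotoneOn (fun x : ℝ => x * (x + 6) / (4 * x + 6) - Real.log (1 + x))
      (Set.Ici 0) := by
    refine monotoneOn_of_deriv_nonneg (convex_Ici 0)
      (fun x hx => (hd x hx).continuousAt.continuousWithinAt)
      (fun x hx => (hd x (interior_subset hx)).differentiableAt.differentiableWithinAt) ?_
    intro x hx
    have hx0 : 0 ≤ x := interior_subset hx
    rw [(hd x hx0).deriv, sub_nonneg, div_le_div_iff₀ (by linarith) (by positivity)]
    nlinarith [pow_nonneg hx0 3]
  have := hmono (Set.mem_Ici.2 le_rfl) (Set.mem_Ici.2 hu) hu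
  simp at this
  linarith

lemma pow_eightyone_le (K : ℕ) : (81 : ℝ) ^ K ≤ Real.exp (K * (91 / 20)) := by
  rw [Real.exp_nat_mul]
  refine pow_le_pow_left₀ (by norm_num) ?_ K
  have h1 : (2.718 : ℝ) ^ 4 ≤ Real.exp 1 ^ 4 :=
    pow_le_pow_left₀ (by norm_num) (by linarith [Real.exp_one_gt_d9]) 4
  have h2 : (1.55 : ℝ) ≤ Real.exp (11 / 20) := by linarith [Real.add_one_le_exp (11 / 20 : ℝ)]
  have h3 : Real.exp (91 / 20) = Real.exp 1 ^ 4 * Real.exp (11 / 20) := by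
    rw [← Real.exp_nat_mul, ← Real.exp_add]
    norm_num
  rw [h3]
  calc (81 : ℝ) ≤ 2.718 ^ 4 * 1.55 := by norm_num
    _ ≤ _ := mul_le_mul h1 h2 (by norm_num) (by positivity)

/-- This fixes the constant `8` in the covariance deviation. With `u = 8w` the Padé rate is `192 w²
/ (32 w + 6)`, and the extreme case `w = 1` gives `192 / 38`, just above `101 / 20`. -/
lemma five_mul_le_rate {n l : ℝ} (hn : 0 < n) (hl : 0 < l) :
    n * (101 / 20) ≤ l * (8 * max √(n / l) (n / l) - Real.log (1 + 8 * max √(n / l) (n / l))) := by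
  set s := n / l with hs
  have hs0 : 0 < s := by positivity
  set w := max √s s with hw
  have hw0 : 0 < w := lt_of_lt_of_le hs0 (le_max_right _ _)
  have hlog := log_one_add_le (u := 8 * w) (by positivity)
  have h1 : s * (101 / 20) ≤ 8 * w - 8 * w * (8 * w + 6) / (4 * (8 * w) + 6) := by
    have h2 : 8 * w - 8 * w * (8 * w + 6) / (4 * (8 * w) + 6) = 192 * w ^ 2 / (32 * w + 6) := by
      field_simp
      ring
    rw [h2, le_div_iff₀ (by positivity)]
    rcases le_total s 1 with h | h
    · have h3 : w = √s := max_eq_left (Real.le_sqrt_of_sq_le (by nlinarith))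
      have h4 : w ^ 2 = s := by rw [h3, Real.sq_sqrt hs0.le]
      have h5 : w ≤ 1 := by rw [h3]; exact Real.sqrt_le_one.2 h
      nlinarith
    · have h3 : w = s := max_eq_right (Real.sqrt_le_left (by linarith) |>.2 (by nlinarith))
      rw [h3]
      nlinarith
  have hn' : n = l * s := by rw [hs]; field_simp
  rw [hn', mul_assoc]
  exact mul_le_mul_of_nonneg_left (by linarith) hl.le

section Noise

variable {Ω : Type*} [MeasurableSpace Ω] {μ : Measure Ω}

lemma IsGaussianNoise.exists_measurable {σ : ℝ} {N L : ℕ} {E : Ω → Matrix (Fin N) (Fin L) ℂ}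
    (hE : IsGaussianNoise μ σ E) : ∃ E' : Ω → Matrix (Fin N) (Fin L) ℂ,
      IsGaussianNoise μ σ E' ∧ (∀ i j, Measurable fun ω => E' ω i j) ∧ E =ᵐ[μ] E' := by
  set E' : Ω → Matrix (Fin N) (Fin L) ℂ := fun ω => Matrix.of fun i j =>
    (hE.law i j).aemeasurable.mk _ ω with hE'
  have hae : ∀ i j, (fun ω => E ω i j) =ᵐ[μ] fun ω => E' ω i j := fun i j =>
    (hE.law i j).aemeasurable.ae_eq_mk
  refine ⟨E', ⟨hE.indep.congr fun q => hae q.1 q.2, fun i j => (hE.law i j).congr (hae i j).symm⟩,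
    fun i j => (hE.law i j).aemeasurable.measurable_mk, ?_⟩
  have h : ∀ᵐ ω ∂μ, ∀ i j, E ω i j = E' ω i j := by
    rw [ae_all_iff]
    intro i
    rw [ae_all_iff]
    exact fun j => hae i j
  filter_upwards [h] with ω hω
  ext i j
  exact hω i j

lemma IsGaussianNoise.transpose {σ : ℝ} {N L : ℕ} {E : Ω → Matrix (Fin N) (Fin L) ℂ}
    (hE : IsGaussianNoise μ σ E) : IsGaussianNoise μ σ fun ω => (E ω)ᵀ where
  indep := hE.indep.precomp (g := fun q : Fin L × Fin N => (q.2, q.1)) fun a b h => by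
    simp only [Prod.mk.injEq] at h
    exact Prod.ext h.2 h.1
  law i j := hE.law j i

lemma IsGaussianNoise.subarray {σ : ℝ} {N L : ℕ} {E : Ω → Matrix (Fin N) (Fin L) ℂ}
    (hE : IsGaussianNoise μ σ E) {M : ℕ} (hM : M ≤ N) (p : Fin (N - M + 1)) :
    IsGaussianNoise μ σ fun ω => subarray M hM p (E ω) where
  indep := hE.indep.precomp
    (g := fun q : Fin M × Fin L => ((⟨p.1 + q.1.1, by omega⟩ : Fin N), q.2)) fun a b h => by
      simp only [Prod.mk.injEq, Fin.mk.injEq] at h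
      exact Prod.ext (Fin.ext (by omega)) h.2
  law i j := hE.law _ j

variable [IsProbabilityMeasure μ]

lemma IsGaussianNoise.indep_mulVec {σ : ℝ} {N L : ℕ} {E : Ω → Matrix (Fin N) (Fin L) ℂ}
    (hE : IsGaussianNoise μ σ E) (hEm : ∀ i j, Measurable fun ω => E ω i j) (c : Fin L → ℂ) :
    iIndepFun (fun i ω => (E ω *ᵥ c) i) μ ∧
      ∀ i, HasLaw (fun ω => (E ω *ᵥ c) i) (complexGaussian (σ * vecNorm c)) μ := by
  constructor
  · have h1 : iIndepFun (fun (p : (_ : Fin N) × Fin L) ω => E ω p.1 p.2) μ :=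
      hE.indep.precomp (g := fun p : (_ : Fin N) × Fin L => (p.1, p.2)) fun a b h => by
        obtain ⟨a1, a2⟩ := a
        obtain ⟨b1, b2⟩ := b
        simp only [Prod.mk.injEq] at h
        obtain ⟨rfl, rfl⟩ := h
        rfl
    exact (iIndepFun_blocks (X := fun i j ω => E ω i j) h1 hEm).comp
      (fun _ v => ∑ j, v j * c j) fun _ => by fun_prop
  · intro i
    exact hasLaw_sum_complexGaussian (X := fun j ω => E ω i j)
      (hE.indep.precomp (g := fun j => (i, j)) fun a b h => by simpa using h)
      (fun j => hEm i j) (fun j => hE.law i j) c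

lemma IsGaussianNoise.measure_vecNorm_sq_gt_le {σ : ℝ} {N L : ℕ}
    {E : Ω → Matrix (Fin N) (Fin L) ℂ} (hE : IsGaussianNoise μ σ E)
    (hEm : ∀ i j, Measurable fun ω => E ω i j) {c : Fin L → ℂ} {b : ℝ} (hc : vecNorm c ≤ b)
    {u : ℝ} (hu : 0 ≤ u) :
    μ.real {ω | (1 + u) * (N * (σ ^ 2 * b ^ 2)) < vecNorm (E ω *ᵥ c) ^ 2} ≤
      Real.exp (-(N * (u - Real.log (1 + u)))) := by
  obtain ⟨h1, h2⟩ := hE.indep_mulVec hEm c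
  refine le_trans (measureReal_mono (fun ω hω => ?_) (measure_ne_top μ _))
    (measure_sum_norm_sq_gt_le h1 h2 hu)
  rw [Set.mem_ofPred_eq, vecNorm_sq] at hω
  rw [Set.mem_ofPred_eq]
  refine lt_of_le_of_lt ?_ hω
  have := vecNorm_nonneg c
  rw [mul_pow]
  gcongr

lemma IsGaussianNoise.measure_vecNorm_sq_lt_le {σ : ℝ} {N L : ℕ}
    {E : Ω → Matrix (Fin N) (Fin L) ℂ} (hE : IsGaussianNoise μ σ E)
    (hEm : ∀ i j, Measurable fun ω => E ω i j) {c : Fin L → ℂ} (hc : vecNorm c = 1)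
    {u : ℝ} (hu : 0 ≤ u) :
    μ.real {ω | vecNorm (E ω *ᵥ c) ^ 2 < (1 - u) * (N * σ ^ 2)} ≤
      Real.exp (-(N * (u ^ 2 / 2))) := by
  obtain ⟨h1, h2⟩ := hE.indep_mulVec hEm c
  simp_rw [hc, mul_one] at h2
  simp_rw [vecNorm_sq]
  exact measure_sum_norm_sq_lt_le h1 h2 hu

/-- The numbers balance as `101/20 = 91/20 + 1/2`: the entropy of the net plus the exponent that is
to remain. -/
lemma exp_union_le {K N : ℕ} (hKN : K ≤ N) {s : Finset (Fin K → ℂ)} (hs : s.card ≤ 81 ^ K) {r : ℝ}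
    (hr : N * (101 / 20) ≤ r) : s.card * Real.exp (-r) ≤ Real.exp (-(N : ℝ) / 2) := by
  have h1 : (s.card : ℝ) ≤ Real.exp (K * (91 / 20)) :=
    le_trans (by exact_mod_cast hs) (pow_eightyone_le K)
  have hKN' : (K : ℝ) ≤ N := by exact_mod_cast hKN
  calc s.card * Real.exp (-r) ≤ Real.exp (K * (91 / 20)) * Real.exp (-r) := by gcongr
    _ = Real.exp (K * (91 / 20) + -r) := (Real.exp_add _ _).symm
    _ ≤ _ := Real.exp_le_exp.2 (by linarith)

lemma measureReal_le_card_mul {ι : Type*} (s : Finset ι) (B : Set Ω) (F : ι → Set Ω) {q : ℝ}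
    (hB : ∀ ω ∈ B, ∃ y ∈ s, ω ∈ F y) (hF : ∀ y ∈ s, μ.real (F y) ≤ q) :
    μ.real B ≤ s.card * q := by
  calc μ.real B ≤ μ.real (⋃ y ∈ s, F y) := measureReal_mono (fun ω hω => by
        obtain ⟨y, hy, h⟩ := hB ω hω
        exact Set.mem_biUnion hy h) (measure_ne_top μ _)
    _ ≤ ∑ y ∈ s, μ.real (F y) := measureReal_biUnion_finset_le _ _
    _ ≤ ∑ y ∈ s, q := Finset.sum_le_sum hF
    _ = s.card * q := by rw [Finset.sum_const, nsmul_eq_mul]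

/-- For a fixed unit vector `y`, the entries of `E Sᴴ y` are i.i.d. Gaussian with variance at most
`σ² ‖S‖²`. The choice `u = 8` makes the threshold `1 + u = 3²`, and the net turns `3` into `4`. -/
lemma IsGaussianNoise.measure_norm_mul_conjTranspose_gt_le {σ : ℝ} (hσ : 0 ≤ σ) {N L K : ℕ}
    (hKN : K ≤ N) {E : Ω → Matrix (Fin N) (Fin L) ℂ} (hE : IsGaussianNoise μ σ E)
    (hEm : ∀ i j, Measurable fun ω => E ω i j) (S : Matrix (Fin K) (Fin L) ℂ) :
    μ.real {ω | 4 * (σ * √(N : ℝ) * ‖S‖) < ‖E ω * Sᴴ‖} ≤ Real.exp (-(N : ℝ) / 2) := by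
  obtain ⟨s, hcard, hs1, hs⟩ := exists_sphere_net K
  have hrate : (N : ℝ) * (101 / 20) ≤ N * (8 - Real.log (1 + 8)) := by
    have := log_one_add_le (u := 8) (by norm_num)
    norm_num at this ⊢
    exact mul_le_mul_of_nonneg_left (by linarith) (Nat.cast_nonneg N)
  refine le_trans (measureReal_le_card_mul s _
    (fun y => {ω | (1 + 8) * (N * (σ ^ 2 * ‖S‖ ^ 2)) < vecNorm (E ω *ᵥ (Sᴴ *ᵥ y)) ^ 2})
    (fun ω hω => ?_) fun y hy => hE.measure_vecNorm_sq_gt_le hEm ?_ (by norm_num))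
    (exp_union_le hKN hcard hrate)
  · by_contra! hfar
    rw [Set.mem_ofPred_eq] at hω
    refine hω.not_ge (opNorm_le_of_net hs _ (by positivity) fun y hy => ?_)
    have h1 := hfar y hy
    rw [Set.mem_ofPred_eq, not_lt] at h1
    rw [← Matrix.mulVec_mulVec]
    refine le_of_sq_le_sq (h1.trans_eq ?_) (by positivity)
    rw [mul_pow, mul_pow, mul_pow, Real.sq_sqrt (Nat.cast_nonneg N)]
    ring
  · have := vecNorm_mulVec_le Sᴴ y
    rwa [hs1 y hy, mul_one, Matrix.l2_opNorm_conjTranspose] at this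

lemma vecNorm_star {ι : Type*} [Fintype ι] (v : ι → ℂ) : vecNorm (star v) = vecNorm v := by
  rw [← sq_eq_sq₀ (vecNorm_nonneg _) (vecNorm_nonneg _), vecNorm_sq, vecNorm_sq]
  simp

lemma conjTranspose_mulVec {N L : ℕ} (E : Matrix (Fin N) (Fin L) ℂ) (y : Fin N → ℂ) :
    Eᴴ *ᵥ y = star (Eᵀ *ᵥ star y) := by
  rw [Matrix.star_mulVec, star_star, Matrix.conjTranspose, Matrix.transpose_map]
  ext i
  simp [Matrix.mulVec, Matrix.vecMul, dotProduct, mul_comm]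

/-- At a unit vector `y` the quadratic form is `‖Eᵀ ȳ‖² / L - σ²`, where `Eᵀ ȳ` has `L` i.i.d.
entries. The upper and the lower tail account for the factor `2` in the probability. -/
lemma IsGaussianNoise.measure_norm_sampleCov_sub_gt_le {σ : ℝ} {N L : ℕ} (hN : 1 ≤ N)
    (hL : 1 ≤ L) {E : Ω → Matrix (Fin N) (Fin L) ℂ} (hE : IsGaussianNoise μ σ E)
    (hEm : ∀ i j, Measurable fun ω => E ω i j) :
    μ.real {ω | 2 * (8 * σ ^ 2 * max √((N : ℝ) / L) ((N : ℝ) / L)) <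
      ‖sampleCov (E ω) - ((σ ^ 2 : ℝ) : ℂ) • 1‖} ≤ 2 * Real.exp (-(N : ℝ) / 2) := by
  obtain ⟨s, hcard, hs1, hs⟩ := exists_sphere_net N
  have hN0 : (0 : ℝ) < N := by exact_mod_cast hN
  have hL0 : (0 : ℝ) < L := by exact_mod_cast hL
  set u := 8 * max √((N : ℝ) / L) ((N : ℝ) / L) with hu
  have hu0 : 0 ≤ u := by positivity
  have hEt := hE.transpose
  have hEtm : ∀ i j, Measurable fun ω => (E ω)ᵀ i j := fun i j => hEm j i
  have hc1 : ∀ y ∈ s, vecNorm (star y) = 1 := fun y hy => by rw [vecNorm_star, hs1 y hy]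
  have hrate1 : (N : ℝ) * (101 / 20) ≤ L * (u - Real.log (1 + u)) := five_mul_le_rate hN0 hL0
  have hrate2 : (N : ℝ) * (101 / 20) ≤ L * (u ^ 2 / 2) := by
    have h1 : (8 * √((N : ℝ) / L)) ^ 2 ≤ u ^ 2 := by
      rw [hu]
      gcongr
      exact le_max_left _ _
    rw [mul_pow, Real.sq_sqrt (by positivity)] at h1
    have h2 := mul_le_mul_of_nonneg_left h1 hL0.le
    rw [show (L : ℝ) * (8 ^ 2 * (N / L)) = 64 * N by field_simp; norm_num] at h2
    nlinarith
  set F₁ : (Fin N → ℂ) → Set Ω := fun y =>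
    {ω | (1 + u) * (L * (σ ^ 2 * 1 ^ 2)) < vecNorm ((E ω)ᵀ *ᵥ star y) ^ 2} with hF₁
  set F₂ : (Fin N → ℂ) → Set Ω := fun y =>
    {ω | vecNorm ((E ω)ᵀ *ᵥ star y) ^ 2 < (1 - u) * (L * σ ^ 2)} with hF₂
  have hb : ∀ y ∈ s, μ.real (F₁ y ∪ F₂ y) ≤
      Real.exp (-(L * (u - Real.log (1 + u)))) + Real.exp (-(L * (u ^ 2 / 2))) := fun y hy =>
    (measureReal_union_le _ _).trans (add_le_add
      (hEt.measure_vecNorm_sq_gt_le hEtm (hc1 y hy).le hu0)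
      (hEt.measure_vecNorm_sq_lt_le hEtm (hc1 y hy) hu0))
  refine le_trans (measureReal_le_card_mul s _ (fun y => F₁ y ∪ F₂ y) (fun ω hω => ?_) hb) ?_
  · by_contra! hfar
    rw [Set.mem_ofPred_eq] at hω
    have hherm : (sampleCov (E ω) - ((σ ^ 2 : ℝ) : ℂ) • (1 : Matrix (Fin N) (Fin N) ℂ)).IsHermitian := by
      rw [Matrix.IsHermitian, sampleCov, Matrix.conjTranspose_sub, Matrix.conjTranspose_smul,
        Matrix.conjTranspose_smul, Matrix.conjTranspose_mul, Matrix.conjTranspose_conjTranspose,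
        Matrix.conjTranspose_one]
      simp
    refine hω.not_ge (opNorm_le_of_net_quadForm hs1 hs hherm (by positivity) fun y hy => ?_)
    have h1 := hfar y hy
    rw [Set.mem_union, not_or, hF₁, hF₂, Set.mem_ofPred_eq, Set.mem_ofPred_eq, not_lt, not_lt] at h1
    have h2 : star y ⬝ᵥ ((sampleCov (E ω) - ((σ ^ 2 : ℝ) : ℂ) • (1 : Matrix (Fin N) (Fin N) ℂ)) *ᵥ y) =
        ((vecNorm ((E ω)ᵀ *ᵥ star y) ^ 2 / L - σ ^ 2 : ℝ) : ℂ) := by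
      rw [Matrix.sub_mulVec, dotProduct_sub, sampleCov, Matrix.smul_mulVec, Matrix.smul_mulVec,
        dotProduct_smul, dotProduct_smul, Matrix.one_mulVec, star_dotProduct_self, hs1 y hy,
        ← Matrix.mulVec_mulVec]
      have h3 := mulVec_star_dotProduct (E ω)ᴴ y ((E ω)ᴴ *ᵥ y)
      rw [Matrix.conjTranspose_conjTranspose] at h3
      rw [← h3, star_dotProduct_self, conjTranspose_mulVec, vecNorm_star]
      simp only [smul_eq_mul]
      push_cast
      ring
    rw [h2, Complex.ofReal_re, abs_le]
    set X := vecNorm ((E ω)ᵀ *ᵥ star y) ^ 2 with hX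
    have h4 : X / L ≤ (1 + u) * σ ^ 2 := by
      rw [div_le_iff₀ hL0]
      linarith [h1.1]
    have h5 : (1 - u) * σ ^ 2 ≤ X / L := by
      rw [le_div_iff₀ hL0]
      linarith [h1.2]
    constructor <;> nlinarith
  · rw [mul_add, two_mul]
    exact add_le_add (exp_union_le le_rfl hcard hrate1) (exp_union_le le_rfl hcard hrate2)

/-- The noise matrix satisfies the deviation bounds on which the error bounds rest. -/
structure IsTypicalNoise {M K L : ℕ} (σ : ℝ) (S : Matrix (Fin K) (Fin L) ℂ)
    (E : Matrix (Fin M) (Fin L) ℂ) : Prop where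
  cross : ‖E * Sᴴ‖ ≤ 4 * (σ * √(M : ℝ) * ‖S‖)
  cov : ‖sampleCov E - ((σ ^ 2 : ℝ) : ℂ) • 1‖ ≤
    2 * (8 * σ ^ 2 * max √((M : ℝ) / L) ((M : ℝ) / L))

theorem IsGaussianNoise.measure_not_isTypicalNoise_le {σ : ℝ} (hσ : 0 ≤ σ) {M K L : ℕ}
    (hM : 1 ≤ M) (hL : 1 ≤ L) (hKM : K ≤ M) {E : Ω → Matrix (Fin M) (Fin L) ℂ}
    (hE : IsGaussianNoise μ σ E) (S : Matrix (Fin K) (Fin L) ℂ) :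
    μ.real {ω | ¬ IsTypicalNoise σ S (E ω)} ≤ 3 * Real.exp (-(M : ℝ) / 2) := by
  obtain ⟨E', hE', hEm, hae⟩ := hE.exists_measurable
  have h1 : μ.real {ω | ¬ IsTypicalNoise σ S (E ω)} = μ.real {ω | ¬ IsTypicalNoise σ S (E' ω)} := by
    refine measureReal_congr ?_
    filter_upwards [hae] with ω hω
    change (¬ IsTypicalNoise σ S (E ω)) = (¬ IsTypicalNoise σ S (E' ω))
    rw [hω]
  rw [h1]
  have h2 := hE'.measure_norm_mul_conjTranspose_gt_le hσ hKM hEm S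
  have h3 := hE'.measure_norm_sampleCov_sub_gt_le hM hL hEm
  refine le_trans ((measureReal_mono (fun ω hω => ?_) (measure_ne_top μ _)).trans
    (measureReal_union_le _ _)) ((add_le_add h2 h3).trans_eq (by ring))
  rw [Set.mem_ofPred_eq] at hω
  by_contra h
  rw [Set.mem_union, not_or, Set.mem_ofPred_eq, Set.mem_ofPred_eq, not_lt, not_lt] at h
  exact hω ⟨h.1, h.2⟩

lemma holdsWithProbAtLeast_of_forall {n : ℕ} {Q : Ω → Prop} {G : Fin n → Ω → Prop} {q : ℝ}
    (hG : ∀ p, μ.real {ω | ¬ G p ω} ≤ q) (hQ : ∀ ω, (∀ p, G p ω) → Q ω) :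
    HoldsWithProbAtLeast μ (1 - n * q) Q := by
  -- The entries of `E` are only almost everywhere measurable, so the bad event is replaced by a
  -- measurable hull of equal measure.
  set B : Set Ω := toMeasurable μ {ω | ¬ ∀ p, G p ω} with hB
  refine ⟨Bᶜ, (measurableSet_toMeasurable _ _).compl, ?_, fun ω hω => hQ ω ?_⟩
  · rw [probReal_compl_eq_one_sub (measurableSet_toMeasurable _ _)]
    have h1 : μ.real B = μ.real {ω | ¬ ∀ p, G p ω} := by
      rw [measureReal_def, measureReal_def, hB, measure_toMeasurable]
    have h2 := measureReal_le_card_mul (μ := μ) Finset.univ {ω | ¬ ∀ p, G p ω}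
      (fun p => {ω | ¬ G p ω}) (fun ω hω => by
        rw [Set.mem_ofPred_eq, not_forall] at hω
        obtain ⟨p, hp⟩ := hω
        exact ⟨p, Finset.mem_univ p, hp⟩) fun p _ => hG p
    rw [Finset.card_univ, Fintype.card_fin] at h2
    linarith
  · by_contra h
    exact hω (subset_toMeasurable _ _ h)

end Noise

/-! ### The structure of the sample covariance matrices -/

lemma norm_eq_sqrt_mul_norm_sampleCov {K L : ℕ} (hL : 1 ≤ L) (S : Matrix (Fin K) (Fin L) ℂ) :
    ‖S‖ = √(L : ℝ) * ‖sampleCov S‖ ^ (1 / 2 : ℝ) := by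
  have hL0 : (0 : ℝ) < L := by exact_mod_cast hL
  have h1 : ‖S * Sᴴ‖ = ‖S‖ * ‖S‖ := by
    have := Matrix.l2_opNorm_conjTranspose_mul_self Sᴴ
    rwa [Matrix.conjTranspose_conjTranspose, Matrix.l2_opNorm_conjTranspose] at this
  rw [← Real.sqrt_eq_rpow, ← Real.sqrt_mul hL0.le, sampleCov, norm_smul, h1]
  have h2 : (L : ℝ) * (‖(1 / (L : ℂ))‖ * (‖S‖ * ‖S‖)) = ‖S‖ * ‖S‖ := by
    rw [norm_div, norm_one, Complex.norm_natCast]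
    field_simp
  rw [h2, Real.sqrt_mul_self (norm_nonneg _)]

/-- The decomposition of the sample covariance of noisy data into signal, noise floor and a small
deviation. -/
lemma IsTypicalNoise.exists_deviation {σ : ℝ} (hσ : 0 ≤ σ) {M K L : ℕ} (hL : 1 ≤ L)
    {S : Matrix (Fin K) (Fin L) ℂ} {E : Matrix (Fin M) (Fin L) ℂ} (hE : IsTypicalNoise σ S E)
    (A : Matrix (Fin M) (Fin K) ℂ) {Q : Matrix (Fin K) (Fin K) ℂ} (hQ : ‖Q‖ ≤ 1) :
    ∃ D, sampleCov (A * (Q * S) + E) =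
        A * (Q * sampleCov S * Qᴴ) * Aᴴ + ((σ ^ 2 : ℝ) : ℂ) • 1 + D ∧
      ‖D‖ ≤ 12 * σ * ‖A‖ * ‖sampleCov S‖ ^ (1 / 2 : ℝ) * √((M : ℝ) / L) +
        16 * σ ^ 2 * max √((M : ℝ) / L) ((M : ℝ) / L) := by
  have hL0 : (0 : ℝ) < L := by exact_mod_cast hL
  -- Grouping the cross term this way leaves `E Sᴴ` free of `Q`, so one event serves every `Q` with
  -- `‖Q‖ ≤ 1`, in particular all powers of `Z`.
  set T := E * Sᴴ * (A * Q)ᴴ with hT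
  refine ⟨(1 / (L : ℂ)) • (Tᴴ + T) + (sampleCov E - ((σ ^ 2 : ℝ) : ℂ) • 1), ?_, ?_⟩
  · have h1 : (A * (Q * S) + E) * (A * (Q * S) + E)ᴴ =
        A * (Q * (S * Sᴴ) * Qᴴ) * Aᴴ + (Tᴴ + T) + E * Eᴴ := by
      rw [hT]
      simp only [Matrix.conjTranspose_add, Matrix.conjTranspose_mul,
        Matrix.conjTranspose_conjTranspose, Matrix.add_mul, Matrix.mul_add, Matrix.mul_assoc]
      abel
    have h2 : A * (Q * sampleCov S * Qᴴ) * Aᴴ =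
        (1 / (L : ℂ)) • (A * (Q * (S * Sᴴ) * Qᴴ) * Aᴴ) := by
      rw [sampleCov]
      simp only [Matrix.mul_smul, Matrix.smul_mul]
    rw [h2, sampleCov, h1, sampleCov, smul_add, smul_add]
    abel
  · have hAQ : ‖A * Q‖ ≤ ‖A‖ :=
      (Matrix.l2_opNorm_mul _ _).trans (mul_le_of_le_one_right (norm_nonneg _) hQ)
    have hTn : ‖T‖ ≤ 4 * (σ * √(M : ℝ) * ‖S‖) * ‖A‖ := by
      refine (Matrix.l2_opNorm_mul _ _).trans ?_
      rw [Matrix.l2_opNorm_conjTranspose]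
      exact mul_le_mul hE.cross hAQ (norm_nonneg _) (by positivity)
    have hTT : ‖Tᴴ + T‖ ≤ 2 * (4 * (σ * √(M : ℝ) * ‖S‖) * ‖A‖) := by
      refine (norm_add_le _ _).trans ?_
      rw [Matrix.l2_opNorm_conjTranspose]
      linarith
    have h1 : ‖(1 / (L : ℂ)) • (Tᴴ + T)‖ ≤
        8 * σ * ‖A‖ * ‖sampleCov S‖ ^ (1 / 2 : ℝ) * √((M : ℝ) / L) := by
      rw [norm_smul, norm_div, norm_one, Complex.norm_natCast, one_div, inv_mul_le_iff₀ hL0]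
      refine hTT.trans_eq ?_
      rw [norm_eq_sqrt_mul_norm_sampleCov hL S, Real.sqrt_div (Nat.cast_nonneg M)]
      have h2 : √(L : ℝ) ≠ 0 := (Real.sqrt_pos.2 hL0).ne'
      have h3 : (L : ℝ) = √(L : ℝ) * √(L : ℝ) := (Real.mul_self_sqrt hL0.le).symm
      field_simp
      rw [Real.sq_sqrt hL0.le]
      ring
    refine (norm_add_le _ _).trans ((add_le_add h1 hE.cov).trans ?_)
    -- The cross terms contribute only the constant `8`; the `12` of the claim leaves slack.
    have h4 : 0 ≤ σ * ‖A‖ * ‖sampleCov S‖ ^ (1 / 2 : ℝ) * √((M : ℝ) / L) := by positivity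
    linarith

section Smoothing

variable {K : ℕ}

lemma nodeMatrix_pow (f : Fin K → ℝ) (p : ℕ) :
    nodeMatrix f ^ p = Matrix.diagonal fun k => node (f k) ^ p := by
  rw [nodeMatrix, Matrix.diagonal_pow]
  rfl

lemma norm_nodeMatrix_pow_le (f : Fin K → ℝ) (p : ℕ) : ‖nodeMatrix f ^ p‖ ≤ 1 := by
  rw [nodeMatrix_pow, Matrix.l2_opNorm_diagonal, pi_norm_le_iff_of_nonneg zero_le_one]
  intro k
  rw [norm_pow, norm_node, one_pow]

lemma subarray_add_steeringMatrix_mul {N L M : ℕ} (hM : M ≤ N) (p : Fin (N - M + 1))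
    (f : Fin K → ℝ) (S : Matrix (Fin K) (Fin L) ℂ) (E : Matrix (Fin N) (Fin L) ℂ) :
    subarray M hM p (steeringMatrix N f * S + E) =
      steeringMatrix M f * (nodeMatrix f ^ p.1 * S) + subarray M hM p E := by
  ext i j
  rw [nodeMatrix_pow]
  simp only [subarray, Matrix.submatrix_apply, Matrix.add_apply, id]
  congr 1
  rw [Matrix.mul_apply, Matrix.mul_apply]
  refine Finset.sum_congr rfl fun k _ => ?_
  rw [Matrix.diagonal_mul]
  simp only [steeringMatrix, Matrix.of_apply, pow_add]
  ring

/-- Conjugation by `Z ^ p` multiplies entry `(i, j)` by `(z_i z̄_j) ^ p`, and averaging over `p`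
produces the entries of `C_P`. -/
lemma fossSourceCov_eq_sum {L : ℕ} (P : ℕ) (f : Fin K → ℝ) (S : Matrix (Fin K) (Fin L) ℂ) :
    fossSourceCov P f S = (1 / (P : ℂ)) •
      ∑ p : Fin P, nodeMatrix f ^ p.1 * sampleCov S * (nodeMatrix f ^ p.1)ᴴ := by
  have h : ∀ (p : ℕ) (i j : Fin K), (nodeMatrix f ^ p * sampleCov S * (nodeMatrix f ^ p)ᴴ) i j =
      node (f i) ^ p * sampleCov S i j * (starRingEnd ℂ) (node (f j)) ^ p := by
    intro p i j
    rw [nodeMatrix_pow, Matrix.diagonal_conjTranspose, Matrix.mul_diagonal, Matrix.diagonal_mul,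
      Pi.star_apply, star_pow, RCLike.star_def]
  ext i j
  rw [fossSourceCov, Matrix.hadamard_apply, corrMatrix, Matrix.smul_apply, Matrix.smul_apply,
    Matrix.sum_apply, smul_eq_mul, smul_eq_mul, mul_left_comm]
  simp_rw [h]
  congr 1
  simp only [conj, Matrix.map_apply, Matrix.mul_apply, Matrix.conjTranspose_apply, steeringMatrix,
    Matrix.of_apply, map_sum, map_mul, map_pow, RCLike.star_def, Complex.conj_conj, Finset.mul_sum]
  refine Finset.sum_congr rfl fun p _ => ?_
  ring

/-- The signal, noise floor and deviation of the forward-only smoothed sample covariance. -/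
lemma exists_fossCov_deviation {σ : ℝ} (hσ : 0 ≤ σ) {N M L : ℕ} (hL : 1 ≤ L) (hM : M ≤ N)
    (f : Fin K → ℝ) (S : Matrix (Fin K) (Fin L) ℂ) {E : Matrix (Fin N) (Fin L) ℂ}
    (hE : ∀ p, IsTypicalNoise σ S (subarray M hM p E)) :
    ∃ D, fossCov M hM (steeringMatrix N f * S + E) =
        steeringMatrix M f * fossSourceCov (N - M + 1) f S * (steeringMatrix M f)ᴴ +
          ((σ ^ 2 : ℝ) : ℂ) • 1 + D ∧
      ‖D‖ ≤ 12 * σ * ‖steeringMatrix M f‖ * ‖sampleCov S‖ ^ (1 / 2 : ℝ) * √((M : ℝ) / L) +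
        16 * σ ^ 2 * max √((M : ℝ) / L) ((M : ℝ) / L) := by
  choose D hD hDn using fun p => (hE p).exists_deviation hσ hL (steeringMatrix M f)
    (norm_nodeMatrix_pow_le f p.1)
  have hP0 : ((N - M + 1 : ℕ) : ℂ) ≠ 0 := Nat.cast_ne_zero.2 (by omega)
  have hP1 : (0 : ℝ) < ((N - M + 1 : ℕ) : ℝ) := Nat.cast_pos.2 (by omega)
  refine ⟨(1 / ((N - M + 1 : ℕ) : ℂ)) • ∑ p, D p, ?_, ?_⟩
  · rw [fossCov]
    simp_rw [subarray_add_steeringMatrix_mul, hD]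
    rw [Finset.sum_add_distrib, Finset.sum_add_distrib, smul_add, smul_add]
    congr 2
    · rw [fossSourceCov_eq_sum, ← Matrix.sum_mul, ← Matrix.mul_sum, Matrix.mul_smul, Matrix.smul_mul]
    · rw [Finset.sum_const, Finset.card_univ, Fintype.card_fin, ← Nat.cast_smul_eq_nsmul ℂ, smul_smul,
        one_div, inv_mul_cancel₀ hP0, one_smul]
  · rw [norm_smul, norm_div, norm_one, Complex.norm_natCast, one_div, inv_mul_le_iff₀ hP1]
    refine (norm_sum_le _ _).trans ((Finset.sum_le_sum fun p _ => hDn p).trans_eq ?_)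
    rw [Finset.sum_const, Finset.card_univ, Fintype.card_fin, nsmul_eq_mul]

lemma conj_mul {m n l : ℕ} (A : Matrix (Fin m) (Fin n) ℂ) (B : Matrix (Fin n) (Fin l) ℂ) :
    conj (A * B) = conj A * conj B := Matrix.map_mul

lemma norm_conj_le {n : ℕ} (D : Matrix (Fin n) (Fin n) ℂ) : ‖conj D‖ ≤ ‖D‖ := by
  refine opNorm_le_of_mulVec _ (norm_nonneg _) fun v => ?_
  have h : conj D *ᵥ v = star (D *ᵥ star v) := by
    ext i
    simp [conj, Matrix.mulVec, dotProduct]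
  rw [h, vecNorm_star]
  exact (vecNorm_mulVec_le D (star v)).trans_eq (by rw [vecNorm_star])

lemma reversal_mul_apply {n l : ℕ} (B : Matrix (Fin n) (Fin l) ℂ) (i : Fin n) (j : Fin l) :
    (reversal n * B) i j = B i.rev j := by
  simp [reversal, Matrix.mul_apply]

lemma reversal_mul_reversal (n : ℕ) : reversal n * reversal n = 1 := by
  ext i j
  rw [reversal_mul_apply, reversal, Matrix.of_apply, Fin.rev_rev, Matrix.one_apply]
  simp [eq_comm]

lemma reversal_conjTranspose (n : ℕ) : (reversal n)ᴴ = reversal n := by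
  ext i j
  simp only [reversal, Matrix.conjTranspose_apply, Matrix.of_apply]
  have : i = j.rev ↔ j = i.rev := by rw [eq_comm, Fin.rev_eq_iff]
  by_cases h : j = i.rev
  · rw [if_pos h, if_pos (this.2 h), star_one]
  · rw [if_neg h, if_neg fun h' => h (this.1 h'), star_zero]

lemma norm_reversal_le (n : ℕ) : ‖reversal n‖ ≤ 1 :=
  opNorm_le_of_mulVec _ zero_le_one fun v => by
    rw [one_mul, vecNorm_mulVec_of_isometry
      (by rw [reversal_conjTranspose, reversal_mul_reversal])]

lemma star_node_mul_node (a : ℝ) : star (node a) * node a = 1 := by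
  rw [RCLike.star_def, Complex.conj_mul', norm_node]
  simp

/-- On the unit circle, `z̄ ^ (M - 1 - i) = z ^ i z̄ ^ (M - 1)`. Backward smoothing therefore keeps
the array matrix and changes only the source covariance. -/
lemma reversal_mul_conj_steeringMatrix {M : ℕ} (f : Fin K → ℝ) :
    reversal M * conj (steeringMatrix M f) =
      steeringMatrix M f * (nodeMatrix f ^ (M - 1))ᴴ := by
  ext i k
  rw [reversal_mul_apply, nodeMatrix_pow, Matrix.diagonal_conjTranspose, Matrix.mul_diagonal]
  simp only [conj, steeringMatrix, Matrix.map_apply, Matrix.of_apply, Fin.val_rev, Pi.star_apply,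
    map_pow, star_pow]
  have h1 : M - 1 = (M - (i.1 + 1)) + i.1 := by omega
  rw [h1, pow_add, mul_left_comm, ← mul_pow, mul_comm (node (f k)), star_node_mul_node, one_pow,
    mul_one]
  rfl

lemma nodeMatrix_zpow_sub_one {M : ℕ} (hM : 1 ≤ M) (f : Fin K → ℝ) :
    nodeMatrix f ^ ((M : ℤ) - 1) = nodeMatrix f ^ (M - 1) := by
  rw [← zpow_natCast, Nat.cast_sub hM, Nat.cast_one]

lemma nodeMatrix_zpow_one_sub {M : ℕ} (hM : 1 ≤ M) (f : Fin K → ℝ) :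
    nodeMatrix f ^ (1 - (M : ℤ)) = (nodeMatrix f ^ (M - 1))ᴴ := by
  have h1 : (1 - (M : ℤ)) = -((M - 1 : ℕ) : ℤ) := by push_cast [hM]; ring
  rw [h1, Matrix.zpow_neg_natCast]
  refine Matrix.inv_eq_left_inv ?_
  rw [nodeMatrix_pow, Matrix.diagonal_conjTranspose, Matrix.diagonal_mul_diagonal,
    ← Matrix.diagonal_one]
  congr 1
  ext k
  rw [Pi.star_apply, star_pow, ← mul_pow, star_node_mul_node, one_pow]

/-- The signal, noise floor and deviation of the forward-backward smoothed sample covariance. -/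
lemma exists_fbssCov_deviation {σ : ℝ} (hσ : 0 ≤ σ) {N M L : ℕ} (hL : 1 ≤ L) (hM1 : 1 ≤ M)
    (hM : M ≤ N) (f : Fin K → ℝ) (S : Matrix (Fin K) (Fin L) ℂ) {E : Matrix (Fin N) (Fin L) ℂ}
    (hE : ∀ p, IsTypicalNoise σ S (subarray M hM p E)) :
    ∃ D, fbssCov M hM (steeringMatrix N f * S + E) =
        steeringMatrix M f * fbssSourceCov M (N - M + 1) f S * (steeringMatrix M f)ᴴ +
          ((σ ^ 2 : ℝ) : ℂ) • 1 + D ∧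
      ‖D‖ ≤ 12 * σ * ‖steeringMatrix M f‖ * ‖sampleCov S‖ ^ (1 / 2 : ℝ) * √((M : ℝ) / L) +
        16 * σ ^ 2 * max √((M : ℝ) / L) ((M : ℝ) / L) := by
  obtain ⟨D, hD, hDn⟩ := exists_fossCov_deviation hσ hL hM f S hE
  set A := steeringMatrix M f with hA
  set B := fossSourceCov (N - M + 1) f S with hB
  set J := reversal M with hJ
  set W := nodeMatrix f ^ (M - 1) with hW
  refine ⟨(1 / 2 : ℂ) • (D + J * conj D * J), ?_, ?_⟩
  · have h1 : J * conj (A * B * Aᴴ) * J = A * (Wᴴ * conj B * W) * Aᴴ := by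
      have h2 : J * conj A = A * Wᴴ := reversal_mul_conj_steeringMatrix f
      have h3 : conj Aᴴ * J = W * Aᴴ := by
        have := congrArg Matrix.conjTranspose h2
        rwa [Matrix.conjTranspose_mul, Matrix.conjTranspose_mul, reversal_conjTranspose,
          Matrix.conjTranspose_conjTranspose] at this
      rw [conj_mul, conj_mul, ← Matrix.mul_assoc, ← Matrix.mul_assoc, h2, Matrix.mul_assoc, h3]
      simp only [Matrix.mul_assoc]
    have h4 : J * conj (((σ ^ 2 : ℝ) : ℂ) • (1 : Matrix (Fin M) (Fin M) ℂ)) * J =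
        ((σ ^ 2 : ℝ) : ℂ) • 1 := by
      have : conj (((σ ^ 2 : ℝ) : ℂ) • (1 : Matrix (Fin M) (Fin M) ℂ)) = ((σ ^ 2 : ℝ) : ℂ) • 1 := by
        ext i j
        by_cases h : i = j <;> simp [conj, h]
      rw [this, Matrix.mul_smul, Matrix.mul_one, Matrix.smul_mul, hJ, reversal_mul_reversal]
    have h5 : ∀ X Y : Matrix (Fin M) (Fin M) ℂ, conj (X + Y) = conj X + conj Y := fun X Y => by
      ext i j
      simp [conj]
    rw [fbssCov, hD, fbssSourceCov, nodeMatrix_zpow_sub_one hM1, nodeMatrix_zpow_one_sub hM1, h5, h5,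
      Matrix.mul_add, Matrix.mul_add, Matrix.add_mul, Matrix.add_mul, h1, h4, Matrix.mul_smul,
      Matrix.smul_mul, Matrix.mul_add, Matrix.add_mul]
    have h6 : ((σ ^ 2 : ℝ) : ℂ) • (1 : Matrix (Fin M) (Fin M) ℂ) =
        (1 / 2 : ℂ) • (((σ ^ 2 : ℝ) : ℂ) • 1 + ((σ ^ 2 : ℝ) : ℂ) • 1) := by
      rw [← two_smul ℂ, smul_smul]
      norm_num
    conv_rhs => rw [h6]
    rw [← smul_add, ← smul_add]
    congr 1
    abel
  · refine le_trans ?_ hDn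
    -- Conjugation and reversal do not increase the norm, so the average of `D` and its backward
    -- version obeys the forward-only bound.
    have h1 : ‖J * conj D * J‖ ≤ ‖D‖ := by
      refine (Matrix.l2_opNorm_mul _ _).trans ?_
      refine (mul_le_of_le_one_right (norm_nonneg _) (norm_reversal_le M)).trans ?_
      refine (Matrix.l2_opNorm_mul _ _).trans ?_
      exact (mul_le_of_le_one_left (norm_nonneg _) (norm_reversal_le M)).trans (norm_conj_le D)
    have h2 := norm_add_le D (J * conj D * J)
    rw [norm_smul]
    norm_num
    linarith

end Smoothing

end Esprit

theorem theorem7 {Ω : Type*} [MeasurableSpace Ω] (μ : Measure Ω) [IsProbabilityMeasure μ]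
    (N K L : ℕ) (hK : 1 ≤ K) (hL : 1 ≤ L)
    (f : Fin K → ℝ) (hf : ∀ k, f k ∈ Set.Ico (0 : ℝ) 1) (hf_inj : Function.Injective f)
    (S : Matrix (Fin K) (Fin L) ℂ) (σ : ℝ) (hσ : 0 ≤ σ)
    (E : Ω → Matrix (Fin N) (Fin L) ℂ) (hE : Esprit.IsGaussianNoise μ σ E)
    (Y : Ω → Matrix (Fin N) (Fin L) ℂ)
    (hY : ∀ ω, Y ω = Esprit.steeringMatrix N f * S + E ω) :
    -- ESPRIT
    (∀ hNK : K + 1 ≤ N, (Esprit.sampleCov S).PosDef →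
      Esprit.HoldsWithProbAtLeast μ (1 - 3 * Real.exp (-(N : ℝ) / 2)) fun ω =>
        ∀ g : Fin K → ℝ,
          Esprit.IsEspritEstimate (Nat.le_of_succ_le hNK) (Esprit.sampleCov (Y ω)) g →
          Esprit.matchedDist g f ≤
            Esprit.errorBound L σ (Esprit.steeringMatrix N f)
              (Esprit.sampleCov S) (Esprit.sampleCov S)) ∧
    -- FOSS-ESPRIT
    (∀ (M P : ℕ) (hM : M ≤ N) (_ : P = N - M + 1) (hMK : K + 1 ≤ M),
      (Esprit.fossSourceCov P f S).PosDef →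
      Esprit.HoldsWithProbAtLeast μ (1 - 3 * (P : ℝ) * Real.exp (-(M : ℝ) / 2)) fun ω =>
        ∀ g : Fin K → ℝ,
          Esprit.IsEspritEstimate (Nat.le_of_succ_le hMK) (Esprit.fossCov M hM (Y ω)) g →
          Esprit.matchedDist g f ≤
            Esprit.errorBound L σ (Esprit.steeringMatrix M f)
              (Esprit.sampleCov S) (Esprit.fossSourceCov P f S)) ∧
    -- FBSS-ESPRIT
    (∀ (M P : ℕ) (hM : M ≤ N) (_ : P = N - M + 1) (hMK : K + 1 ≤ M),
      (Esprit.fbssSourceCov M P f S).PosDef →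
      Esprit.HoldsWithProbAtLeast μ (1 - 3 * (P : ℝ) * Real.exp (-(M : ℝ) / 2)) fun ω =>
        ∀ g : Fin K → ℝ,
          Esprit.IsEspritEstimate (Nat.le_of_succ_le hMK) (Esprit.fbssCov M hM (Y ω)) g →
          Esprit.matchedDist g f ≤
            Esprit.errorBound L σ (Esprit.steeringMatrix M f)
              (Esprit.sampleCov S) (Esprit.fbssSourceCov M P f S)) := by
  refine ⟨fun hNK hS => ?_, ?_, ?_⟩
  · have hprob := Esprit.holdsWithProbAtLeast_of_forall (μ := μ) (n := 1)
      (Q := fun ω => Esprit.IsTypicalNoise σ S (E ω)) (G := fun _ ω => Esprit.IsTypicalNoise σ S (E ω))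
      (fun _ => hE.measure_not_isTypicalNoise_le hσ (by omega) hL (by omega) S) fun ω h => h 0
    rw [Nat.cast_one, one_mul] at hprob
    obtain ⟨G, hGm, hGp, hG⟩ := hprob
    refine ⟨G, hGm, hGp, fun ω hω g hg => ?_⟩
    -- Without smoothing the full array is the only subarray, with phase matrix `Z ^ 0 = 1`.
    obtain ⟨D, hD, hDn⟩ := (hG ω hω).exists_deviation hσ hL (Esprit.steeringMatrix N f)
      (Q := 1) (by simpa using Esprit.norm_nodeMatrix_pow_le f 0)
    rw [Matrix.one_mul, Matrix.one_mul, Matrix.conjTranspose_one, Matrix.mul_one, ← hY ω] at hD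
    exact hg.matchedDist_le hK hNK hf hf_inj hS hD hDn
  · rintro M P hM rfl hMK hS
    rw [mul_assoc, mul_left_comm]
    refine Esprit.holdsWithProbAtLeast_of_forall
      (G := fun p ω => Esprit.IsTypicalNoise σ S (Esprit.subarray M hM p (E ω)))
      (fun p => (hE.subarray hM p).measure_not_isTypicalNoise_le hσ (by omega) hL (by omega) S)
      fun ω hω g hg => ?_
    obtain ⟨D, hD, hDn⟩ := Esprit.exists_fossCov_deviation hσ hL hM f S hω
    rw [← hY ω] at hD
    exact hg.matchedDist_le hK hMK hf hf_inj hS hD hDn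
  · rintro M P hM rfl hMK hS
    rw [mul_assoc, mul_left_comm]
    refine Esprit.holdsWithProbAtLeast_of_forall
      (G := fun p ω => Esprit.IsTypicalNoise σ S (Esprit.subarray M hM p (E ω)))
      (fun p => (hE.subarray hM p).measure_not_isTypicalNoise_le hσ (by omega) hL (by omega) S)
      fun ω hω g hg => ?_
    obtain ⟨D, hD, hDn⟩ := Esprit.exists_fbssCov_deviation hσ hL (by omega) hM f S hω
    rw [← hY ω] at hD
    exact hg.matchedDist_le hK hMK hf hf_inj hS hD hDn
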